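/- Let $\mathrm{FI}$ be the category of finite sets and injections, and consider $\mathrm{FI}^{\mathrm{op}}$ as a site in which a sieve is covering if and only if it is non-empty. Let $\mathcal O$ be a sheaf of fields on $\mathrm{FI}^{\mathrm{op}}$ that is not constant (that is, not isomorphic to a constant functor). For a finite set $J$ let $\mathcal O_{+J}$ be the sheaf $I\mapsto\mathcal O(I\sqcup J)$. Fix an infinite set $M$ (for instance $M=\mathbb N$) and let $\widetilde{\mathcal O}:=\varinjlim_{J\subset M}\mathcal O_{+J}$ be the colimit over the finite subsets $J$ of $M$ and their inclusions. Then $\widetilde{\mathcal O}$, with the natural morphism $\mathcal O=\mathcal O_{+\varnothing}\to\widetilde{\mathcal O}$, is a weak period sheaf over $\mathcal O$: it is a sheaf of fields extending $\mathcal O$, and $\widetilde{\mathcal O}$ is a cogenerator of the category of sheaves of $\widetilde{\mathcal O}$-modules (for any two distinct morphisms $f,g:V\to W$ of this category there is a morphism $\theta:W\to\widetilde{\mathcal O}$ with $\theta f\neq\theta g$). In terms of representations: let $\Psi$ be an infinite set, let $\mathfrak S_\Psi$ be the group of all its permutations, and call an action of $\mathfrak S_\Psi$ smooth if the stabilizer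 of every point contains the pointwise stabilizer of some finite subset of $\Psi$. Then every field $K$ with a smooth action of $\mathfrak S_\Psi$ by field automorphisms has a field extension $\widetilde K$ with a smooth action of $\mathfrak S_\Psi$ by field automorphisms, extending the action on $K$, such that $\widetilde K$ is a cogenerator of the category $\mathrm{Sm}_{\widetilde K}(\mathfrak S_\Psi)$ of smooth $\widetilde K$-semilinear representations of $\mathfrak S_\Psi$ (whose morphisms are the $\mathfrak S_\Psi$-equivariant $\widetilde K$-linear maps). -/

import Mathlib

open CategoryTheory CategoryTheory.Limits Opposite

universe u v w

/-! ### The site of finite sets and injections -/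

/-- The category `FI`: the objects are the finite sets, the morphisms are the injections. -/
structure FI : Type 1 where
  carrier : Type
  [finite : Finite carrier]

namespace FI

attribute [instance] FI.finite

instance : Category.{0} FI where
  Hom I J := I.carrier ↪ J.carrier
  id I := Function.Embedding.refl I.carrier
  comp f g := f.trans g

/-- An injection between finite sets, as a morphism of `FI`. -/
def homOfEmbedding {I J : FI} (f : I.carrier ↪ J.carrier) : I ⟶ J := f

/-- The injection underlying a morphism of `FI`. -/
def embeddingOfHom {I J : FI} (f : I ⟶ J) : I.carrier ↪ J.carrier := f

theorem hom_ext {I J : FI} {f g : I ⟶ J}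
    (h : ∀ x, embeddingOfHom f x = embeddingOfHom g x) : f = g :=
  Function.Embedding.ext h

/-- The disjoint union of two finite sets. (It is not a coproduct in `FI`.) -/
def sum (I J : FI) : FI := ⟨I.carrier ⊕ J.carrier⟩

/-- Disjoint union of injections. -/
def sumMap {I I' J J' : FI} (f : I ⟶ I') (g : J ⟶ J') : I.sum J ⟶ I'.sum J' :=
  homOfEmbedding ((embeddingOfHom f).sumMap (embeddingOfHom g))

theorem sumMap_id (I J : FI) : sumMap (𝟙 I) (𝟙 J) = 𝟙 (I.sum J) :=
  hom_ext fun x => by rcases x with x | x <;> rfl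

theorem sumMap_comp {I I' I'' J J' J'' : FI} (f : I ⟶ I') (f' : I' ⟶ I'')
    (g : J ⟶ J') (g' : J' ⟶ J'') :
    sumMap (f ≫ f') (g ≫ g') = sumMap f g ≫ sumMap f' g' :=
  hom_ext fun x => by rcases x with x | x <;> rfl

/-- The canonical injection `I ↪ I ⊔ J`. -/
def inl (I J : FI) : I ⟶ I.sum J := homOfEmbedding Function.Embedding.inl

theorem inl_naturality {I I' : FI} (J : FI) (f : I ⟶ I') :
    f ≫ inl I' J = inl I J ≫ sumMap f (𝟙 J) := rfl

/-- Two injections with the same source can be completed to a commutative square. -/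
theorem op_rightOre : GrothendieckTopology.RightOreCondition FIᵒᵖ := by
  classical
  intro X Y Z p q
  let f : X.unop.carrier ↪ Y.unop.carrier := embeddingOfHom p.unop
  let g : X.unop.carrier ↪ Z.unop.carrier := embeddingOfHom q.unop
  let t : Z.unop.carrier → Y.unop.carrier ⊕ Z.unop.carrier := fun z =>
    if h : ∃ x, g x = z then Sum.inl (f h.choose) else Sum.inr z
  have ht : ∀ x, t (g x) = Sum.inl (f x) := by
    intro x
    have h : ∃ x', g x' = g x := ⟨x, rfl⟩
    simp only [t, dif_pos h]
    rw [g.injective h.choose_spec]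
  have ht' : ∀ z, (¬ ∃ x, g x = z) → t z = Sum.inr z := fun z h => dif_neg h
  have hinj : Function.Injective t := by
    intro a b hab
    by_cases ha : ∃ x, g x = a <;> by_cases hb : ∃ x, g x = b
    · obtain ⟨x, rfl⟩ := ha
      obtain ⟨y, rfl⟩ := hb
      rw [ht, ht] at hab
      rw [f.injective (Sum.inl_injective hab)]
    · obtain ⟨x, rfl⟩ := ha
      rw [ht, ht' b hb] at hab
      cases hab
    · obtain ⟨y, rfl⟩ := hb
      rw [ht, ht' a ha] at hab
      cases hab
    · rw [ht' a ha, ht' b hb] at hab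
      exact Sum.inr_injective hab
  refine ⟨op (Y.unop.sum Z.unop), (inl Y.unop Z.unop).op,
    (homOfEmbedding (J := Y.unop.sum Z.unop) ⟨t, hinj⟩).op, ?_⟩
  apply Quiver.Hom.unop_inj
  exact hom_ext fun x => (ht x).symm

/-- The category `FIᵒᵖ` as a site: a sieve is covering if and only if it is non-empty. -/
def site : GrothendieckTopology FIᵒᵖ := GrothendieckTopology.atomic op_rightOre

end FI

/-! ### Sheaves of fields on `FIᵒᵖ` and the shifts `𝒪₊J` -/

/-- A sheaf of rings on `FIᵒᵖ` is a sheaf of fields if all its values are fields. -/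
def IsSheafOfFields (O : Sheaf FI.site RingCat.{u}) : Prop :=
  ∀ I : FI, IsField (O.obj.obj (op (op I)))

/-- A sheaf on `FIᵒᵖ` is constant if it is isomorphic to a constant functor. (A constant
functor is always a sheaf on this site, since the covering sieves are connected.) -/
def IsConstantSheaf (O : Sheaf FI.site RingCat.{u}) : Prop :=
  ∃ A : RingCat.{u}, Nonempty (O.obj ≅ (Functor.const FIᵒᵖᵒᵖ).obj A)

/-- The presheaf `𝒪₊J : I ↦ 𝒪(I ⊔ J)`, as a functor of the finite set `J`. -/
def shift (O : FIᵒᵖᵒᵖ ⥤ RingCat.{u}) : FI ⥤ (FIᵒᵖᵒᵖ ⥤ RingCat.{u}) where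
  obj J :=
    { obj := fun I => O.obj (op (op (I.unop.unop.sum J)))
      map := fun f => O.map (FI.sumMap f.unop.unop (𝟙 J)).op.op
      map_id := fun I => by
        rw [unop_id, unop_id, FI.sumMap_id]
        exact O.map_id _
      map_comp := fun f g => by
        rw [← O.map_comp, ← op_comp, ← op_comp, ← FI.sumMap_comp, Category.comp_id]
        rfl }
  map {J J'} j :=
    { app := fun I => O.map (FI.sumMap (𝟙 I.unop.unop) j).op.op
      naturality := fun I I' f => by
        change O.map _ ≫ O.map _ = O.map _ ≫ O.map _
        rw [← O.map_comp, ← O.map_comp, ← op_comp, ← op_comp, ← op_comp, ← op_comp,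
          ← FI.sumMap_comp, ← FI.sumMap_comp]
        simp only [Category.comp_id, Category.id_comp] }
  map_id J := by
    ext1
    funext I
    change O.map _ = _
    rw [FI.sumMap_id]
    exact O.map_id _
  map_comp {J J' J''} j j' := by
    ext1
    funext I
    change O.map _ = O.map _ ≫ O.map _
    rw [← O.map_comp, ← op_comp, ← op_comp, ← FI.sumMap_comp, Category.comp_id]

/-- The natural morphism `𝒪 ⟶ 𝒪₊J`, given by the inclusions `I ↪ I ⊔ J`. -/
def toShift (O : FIᵒᵖᵒᵖ ⥤ RingCat.{u}) (J : FI) : O ⟶ (shift O).obj J where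
  app I := O.map (FI.inl I.unop.unop J).op.op
  naturality I I' f := by
    change O.map _ ≫ O.map _ = O.map _ ≫ O.map _
    rw [← O.map_comp, ← O.map_comp, ← op_comp, ← op_comp, ← FI.inl_naturality]
    rfl

/-- The finite subsets of `M` and their inclusions, as finite sets and injections. -/
def finiteSubsets (M : Type) : Finset M ⥤ FI where
  obj J := ⟨J⟩
  map {J J'} h := FI.homOfEmbedding (I := ⟨J⟩) (J := ⟨J'⟩)
    ⟨fun x => ⟨x.1, leOfHom h x.2⟩, fun x y hxy => by
      simp only [Subtype.mk.injEq] at hxy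
      exact Subtype.ext hxy⟩
  map_id _ := rfl
  map_comp _ _ := rfl

/-- The colimit `𝒪̃ = colim_J 𝒪₊J` over the finite subsets `J` of a set `M`, taken in the category
of presheaves of rings on `FIᵒᵖ`. -/
noncomputable def tilde (M : Type) (O : FIᵒᵖᵒᵖ ⥤ RingCat.{u}) : FIᵒᵖᵒᵖ ⥤ RingCat.{u} :=
  colimit (finiteSubsets M ⋙ shift O)

/-- The natural morphism `𝒪 ⟶ 𝒪₊∅ ⟶ 𝒪̃`. -/
noncomputable def toTilde (M : Type) (O : FIᵒᵖᵒᵖ ⥤ RingCat.{u}) : O ⟶ tilde M O :=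
  toShift O ((finiteSubsets M).obj ∅) ≫ colimit.ι (finiteSubsets M ⋙ shift O) ∅

/-- A morphism `𝒪 ⟶ 𝒫` of sheaves of rings on `FIᵒᵖ` makes `𝒫` a weak period sheaf over `𝒪` if it
is an extension of sheaves of fields and `𝒫` is a cogenerator of the category of sheaves of
`𝒫`-modules. -/
structure IsWeakPeriodSheaf {O P : Sheaf FI.site RingCat.{u}} (ι : O ⟶ P) : Prop where
  isSheafOfFields_base : IsSheafOfFields O
  isSheafOfFields : IsSheafOfFields P
  injective : ∀ I : FI, Function.Injective (ι.hom.app (op (op I))).hom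
  isCoseparator : IsCoseparator (SheafOfModules.unit P)

/-! ### Smooth semilinear representations -/

/-- Let `G` act on `Ψ`. An action of `G` on `X` is smooth if the stabilizers of all points of `X`
are open in the topology in which the pointwise stabilizers of the finite subsets of `Ψ` form
a base of neighbourhoods of `1`. -/
def IsSmoothAction (G : Type*) (Ψ : Type*) (X : Type*) [Group G] [MulAction G Ψ]
    [MulAction G X] : Prop :=
  ∀ x : X, ∃ T : Finset Ψ, fixingSubgroup G (T : Set Ψ) ≤ MulAction.stabilizer G x

/-- The smooth `K`-semilinear representations of a group `G` acting on a set `Ψ`. -/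
structure SmRep (G : Type v) (Ψ : Type v) (K : Type u) [Group G] [MulAction G Ψ] [Field K]
    [MulSemiringAction G K] : Type (max u v (w + 1)) where
  carrier : Type w
  [addCommGroup : AddCommGroup carrier]
  [module : Module K carrier]
  [action : DistribMulAction G carrier]
  semilinear : ∀ (g : G) (a : K) (x : carrier), g • (a • x) = (g • a) • (g • x)
  smooth : IsSmoothAction G Ψ carrier

namespace SmRep

attribute [instance] SmRep.addCommGroup SmRep.module SmRep.action

variable {G : Type v} {Ψ : Type v} {K : Type u} [Group G] [MulAction G Ψ] [Field K]
  [MulSemiringAction G K]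

/-- Morphisms of semilinear representations: the `G`-equivariant `K`-linear maps. -/
@[ext]
structure Hom (V W : SmRep.{u, v, w} G Ψ K) : Type w where
  toLinearMap : V.carrier →ₗ[K] W.carrier
  equivariant : ∀ (g : G) (x : V.carrier), toLinearMap (g • x) = g • toLinearMap x

/-- The category `Sm_K(G)`. -/
instance : Category.{w} (SmRep.{u, v, w} G Ψ K) where
  Hom V W := Hom V W
  id V := ⟨LinearMap.id, fun _ _ => rfl⟩
  comp f g := ⟨g.toLinearMap.comp f.toLinearMap, fun s x => by
    rw [LinearMap.comp_apply, LinearMap.comp_apply, f.equivariant, g.equivariant]⟩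

/-- A smooth `G`-field `K`, as an object of `Sm_K(G)`. -/
def unit (h : IsSmoothAction G Ψ K) : SmRep.{u, v, u} G Ψ K where
  carrier := K
  semilinear g a x := smul_mul' g a x
  smooth := h

end SmRep

/-- Let `F` be a field with an action of `G`. A field extension `L|F` with an action of `G` is a
weak `G`-period extension if the action on `L` is smooth and extends the action on `F`, and `L` is
a cogenerator of `Sm_L(G)`. -/
structure IsWeakPeriodExtension (G : Type v) (Ψ : Type v) (F : Type u) (L : Type w) [Group G]
    [MulAction G Ψ] [Field F] [MulSemiringAction G F] [Field L] [MulSemiringAction G L]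
    [Algebra F L] : Prop where
  equivariant : ∀ (g : G) (a : F), algebraMap F L (g • a) = g • algebraMap F L a
  smooth : IsSmoothAction G Ψ L
  isCoseparator : IsCoseparator (SmRep.unit smooth)

/-! Both halves rest on `exists_equivariant_ne_zero`. Let `L` be a field on which `Perm (Ψ ⊕ M)`
acts smoothly and nontrivially, regarded as a `Perm Ψ`-field. Then every nonzero vector of a smooth
`L`-semilinear representation of `Perm Ψ` is detected by an equivariant functional to `L`.

The role of `M` is to provide room. Since `M` is infinite, all but one point of a support can be
hidden in it, so `L` has elements that `Perm Ψ` sees as supported at one point and that are moved by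
transpositions (`SeparatesPoints`). Hence permutations with different restrictions to a finite set
are distinct characters on the elements supported there, and Artin's independence applies.

Consider a finitely generated representation. By a form of Hilbert 90 it is spanned by finitely many
families of vectors indexed by the `n`-element subsets of `Ψ`, for various `n`. A dependent vector
of top degree can be eliminated at the price of fixing a finite set `C` and splitting index sets
along `C`. Once the top degree is independent, functionals on it are prescribed freely by orbit
sums. By induction the functionals equivariant under the pointwise stabilizer of some finite set
separate points (`exists_separatedOver_orbitSpan`).

To get equivariance under all of `Perm Ψ`, identify `Ψ` with the complement of that finite set and
push the set into `M` by a permutation of `Ψ ⊕ M`. The result respects linear relations by an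
Artin-style descent on their length (`sum_mul_eq_zero_of_fixed`). Zorn's lemma then reduces an
arbitrary representation to a one-dimensional quotient.

For sheaves, the colimit of the values at finite subsets of an infinite `Ψ` gives smooth
representations. The colimit of `𝒪̃` over `Ψ` is that of `𝒪` over `Ψ ⊕ M`
(`tildeGermHom_bijective`), and non-constancy of `𝒪` is nontriviality of the action. For a field
`K`, adjoining permuted variables makes the action nontrivial, and a bijection `Ψ ⊕ Ψ ≃ Ψ` provides
the extra room. -/

/-! ### Supports of points under the symmetric group. -/

section PermSupports

open MulAction Equiv
open scoped Classical

variable {X : Type*}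

/-- The group generated by the transpositions of points outside `S`. -/
def swapsOff (S : Set X) : Subgroup (Perm X) :=
  Subgroup.closure {g | ∃ a b, a ∉ S ∧ b ∉ S ∧ g = swap a b}

theorem swap_mem_swapsOff {S : Set X} {a b : X} (ha : a ∉ S) (hb : b ∉ S) :
    swap a b ∈ swapsOff S :=
  Subgroup.subset_closure ⟨a, b, ha, hb, rfl⟩

theorem apply_eq_of_mem_swapsOff {S : Set X} {g : Perm X} (hg : g ∈ swapsOff S) :
    ∀ x ∈ S, g x = x := by
  induction hg using Subgroup.closure_induction with
  | mem g hg =>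
    obtain ⟨a, b, ha, hb, rfl⟩ := hg
    intro x hx
    exact swap_apply_of_ne_of_ne (fun h => ha (h ▸ hx)) (fun h => hb (h ▸ hx))
  | one => intro x _; rfl
  | mul g h _ _ hg hh => intro x hx; rw [Perm.mul_apply, hh x hx, hg x hx]
  | inv g _ hg => intro x hx; rw [Perm.inv_eq_iff_eq, hg x hx]

/-- One point at a time: if `g` agrees with `f` on `T`, then `swap (g t) (f t) * g` also agrees at
`t`. Injectivity of `f` on the union keeps this transposition away from `S` and from the values
already reached. -/
theorem exists_mem_swapsOff_eqOn (S : Set X) (T : Finset X) (f : X → X)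
    (hf : Set.InjOn f (S ∪ T)) (hS : ∀ x ∈ S, f x = x) :
    ∃ g ∈ swapsOff S, ∀ t ∈ T, g t = f t := by
  induction T using Finset.induction_on with
  | empty => exact ⟨1, one_mem _, by simp⟩
  | insert t T ht ih =>
    obtain ⟨g, hg, hgT⟩ := ih (hf.mono (by
      intro x hx
      rcases hx with hx | hx
      · exact Or.inl hx
      · exact Or.inr (by simp only [Finset.coe_insert]; exact Or.inr hx)))
    have htm : t ∈ S ∪ ((insert t T : Finset X) : Set X) := Or.inr (by simp)
    by_cases htS : t ∈ S
    · refine ⟨g, hg, fun x hx => ?_⟩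
      rcases Finset.mem_insert.1 hx with rfl | hx
      · rw [apply_eq_of_mem_swapsOff hg x htS, hS x htS]
      · exact hgT x hx
    · refine ⟨swap (g t) (f t) * g, mul_mem (swap_mem_swapsOff ?_ ?_) hg, fun x hx => ?_⟩
      · intro h
        apply htS
        have := g.injective (apply_eq_of_mem_swapsOff hg _ h)
        rwa [this] at h
      · intro h
        have := hf (Or.inl h) htm (hS _ h)
        exact htS (this ▸ h)
      · rcases Finset.mem_insert.1 hx with rfl | hx
        · simp
        · have hxt : x ≠ t := fun h => ht (h ▸ hx)
          rw [Perm.mul_apply, swap_apply_of_ne_of_ne, hgT x hx]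
          · exact fun h => hxt (g.injective h)
          · rw [hgT x hx]
            exact fun h => hxt (hf (Or.inr (by simp [hx])) htm h)

theorem exists_perm_eqOn (T : Finset X) (f : X → X) (hf : Set.InjOn f T) :
    ∃ g : Perm X, ∀ t ∈ T, g t = f t := by
  obtain ⟨g, -, hg⟩ := exists_mem_swapsOff_eqOn ∅ T f (by simpa using hf) (by simp)
  exact ⟨g, hg⟩

variable {Z : Type*} [MulAction (Perm X) Z]

/-- `z` has a finite support. -/
def FinSupported (X : Type*) {Z : Type*} [MulAction (Perm X) Z] (z : Z) : Prop :=
  ∃ T : Finset X, Supports (Perm X) (T : Set X) z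

theorem isSmoothAction_iff :
    IsSmoothAction (Perm X) X Z ↔ ∀ z : Z, FinSupported X z := by
  refine forall_congr' fun z => exists_congr fun T => ?_
  constructor
  · intro h g hg
    exact h ((mem_fixingSubgroup_iff _).2 fun y hy => hg hy)
  · intro h g hg
    exact h g fun a ha => (mem_fixingSubgroup_iff _).1 hg a ha

theorem MulAction.Supports.smul_eq {S : Set X} {z : Z} (h : Supports (Perm X) S z)
    {g g' : Perm X} (hg : ∀ x ∈ S, g x = g' x) : g • z = g' • z := by
  rw [← inv_smul_eq_iff, smul_smul]
  refine h _ fun a ha => ?_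
  rw [Perm.smul_def, Perm.mul_apply, Perm.inv_eq_iff_eq]
  exact (hg a ha)

theorem MulAction.Supports.smul_image {S : Set X} {z : Z} (h : Supports (Perm X) S z)
    (g : Perm X) : Supports (Perm X) (g '' S) (g • z) := by
  intro k hk
  rw [smul_smul]
  exact h.smul_eq fun x hx => hk ⟨x, hx, rfl⟩

/-- A finitely supported point that is fixed by all transpositions off `S` is supported by `S`. -/
theorem FinSupported.supports_of_swap {z : Z} (hz : FinSupported X z) {S : Set X}
    (h : ∀ a b, a ∉ S → b ∉ S → a ≠ b → swap a b • z = z) : Supports (Perm X) S z := by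
  obtain ⟨T, hT⟩ := hz
  intro g hg
  -- On the finite support `T`, `g` cannot be told apart from a product `k` of transpositions off
  -- `S`.
  obtain ⟨k, hk, hkT⟩ := exists_mem_swapsOff_eqOn S T g g.injective.injOn fun x hx => hg hx
  rw [hT.smul_eq fun x hx => (hkT x hx).symm]
  have : swapsOff S ≤ stabilizer (Perm X) z := by
    rw [swapsOff, Subgroup.closure_le]
    rintro _ ⟨a, b, ha, hb, rfl⟩
    by_cases hab : a = b
    · subst hab
      rw [swap_self]
      exact one_smul _ z
    · exact h a b ha hb hab
  exact this hk

/-- A point `c` outside both supports serves as an intermediary: `(a b) = (a c)(b c)(a c)`. Each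
factor fixes `z`, because a point off the intersection is off one of the two supports. -/
theorem FinSupported.supports_inter {z : Z} (hz : FinSupported X z) {S S' : Set X}
    (hS : Supports (Perm X) S z) (hS' : Supports (Perm X) S' z) (hinf : (S ∪ S')ᶜ.Infinite) :
    Supports (Perm X) (S ∩ S') z := by
  have key : ∀ a c, a ∉ S ∩ S' → c ∉ S ∪ S' → swap a c • z = z := by
    intro a c ha hc
    have aux : ∀ {R : Set X}, Supports (Perm X) R z → a ∉ R → c ∉ R → swap a c • z = z :=
      fun hR haR hcR => hR _ fun x hx => swap_apply_of_ne_of_ne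
        (fun h => haR (h ▸ hx)) (fun h => hcR (h ▸ hx))
    by_cases haS : a ∈ S
    · exact aux hS' (fun h => ha ⟨haS, h⟩) fun h => hc (Or.inr h)
    · exact aux hS haS fun h => hc (Or.inl h)
  refine hz.supports_of_swap fun a b ha hb hab => ?_
  obtain ⟨c, hc, hc'⟩ := hinf.exists_notMem_finset {a, b}
  have hca : c ≠ a := fun h => hc' (by simp [h])
  have hcb : c ≠ b := fun h => hc' (by simp [h])
  have : swap a b = swap a c * swap b c * swap a c := by
    rw [swap_comm a c, swap_mul_swap_mul_swap hcb.symm (Ne.symm hab)]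
  rw [this, mul_smul, mul_smul, key a c ha hc, key b c hb hc, key a c ha hc]

theorem FinSupported.exists_subset {z : Z} (hz : FinSupported X z) {S : Set X}
    (hS : Supports (Perm X) S z) (hinf : Sᶜ.Infinite) :
    ∃ T : Finset X, (T : Set X) ⊆ S ∧ Supports (Perm X) (T : Set X) z := by
  obtain ⟨T, hT⟩ := hz
  refine ⟨T.filter (· ∈ S), by intro x; simp, ?_⟩
  have := FinSupported.supports_inter ⟨T, hT⟩ hT hS (by
    rw [Set.compl_union, Set.inter_comm, ← Set.sdiff_eq]
    exact hinf.sdiff T.finite_toSet)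
  convert this using 1
  ext x
  simp

/-! ### Sums over the bijections of two finite sets -/

/-- A permutation that fixes `B` and extends `e`, if there is one. -/
noncomputable def extPerm (B : Finset X) {T A : Finset X} (e : T ≃ A) : Perm X :=
  if h : ∃ g : Perm X, (∀ b ∈ B, g b = b) ∧ ∀ t : T, g t = e t then h.choose else 1

/-- Disjointness makes the identity of `B` and `e` glue to an injection, so the default value `1` of
`extPerm` does not occur here. -/
theorem extPerm_spec {B T A : Finset X} (hT : Disjoint T B) (hA : Disjoint A B) (e : T ≃ A) :
    (∀ b ∈ B, extPerm B e b = b) ∧ ∀ t : T, extPerm B e t = e t := by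
  have h : ∃ g : Perm X, (∀ b ∈ B, g b = b) ∧ ∀ t : T, g t = e t := by
    let f : X → X := fun x => if h : x ∈ T then e ⟨x, h⟩ else x
    have hfB : ∀ b ∈ B, f b = b := fun b hb =>
      dif_neg (fun h => Finset.disjoint_left.1 hT h hb)
    have hfT : ∀ t : T, f t = e t := fun t => dif_pos t.2
    obtain ⟨g, hg, hgT⟩ := exists_mem_swapsOff_eqOn (B : Set X) T f (by
      rintro x (hx | hx) y (hy | hy) hxy
      · rwa [hfB x hx, hfB y hy] at hxy
      · rw [hfB x hx, hfT ⟨y, hy⟩] at hxy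
        exact (Finset.disjoint_left.1 hA (e ⟨y, hy⟩).2 (hxy ▸ hx)).elim
      · rw [hfB y hy, hfT ⟨x, hx⟩] at hxy
        exact (Finset.disjoint_left.1 hA (e ⟨x, hx⟩).2 (hxy ▸ hy)).elim
      · rw [hfT ⟨x, hx⟩, hfT ⟨y, hy⟩] at hxy
        exact congrArg Subtype.val (e.injective (Subtype.ext hxy))) hfB
    exact ⟨g, apply_eq_of_mem_swapsOff hg, fun t => by rw [hgT t t.2, hfT t]⟩
  rw [extPerm, dif_pos h]
  exact h.choose_spec

variable {W : Type*} [AddCommMonoid W] [DistribMulAction (Perm X) W]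

/-- The sum of the translates of `x` by the bijections `T ≃ A`. -/
noncomputable def orbitSum (B T : Finset X) (x : W) (A : Finset X) : W :=
  ∑ e : T ≃ A, extPerm B e • x

/-- Composition with `g` permutes the summands: it matches the bijections `T ≃ A` with the
bijections `T ≃ g A`, and the translates of `x` depend only on restrictions to its support. -/
theorem smul_orbitSum {B T A : Finset X} {x : W} (hx : Supports (Perm X) ((T : Set X) ∪ B) x)
    (hT : Disjoint T B) (hA : Disjoint A B) {g : Perm X} (hg : ∀ b ∈ B, g b = b) :
    g • orbitSum B T x A = orbitSum B T x (A.map g.toEmbedding) := by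
  have hA' : Disjoint (A.map g.toEmbedding) B := by
    rw [Finset.disjoint_left] at hA ⊢
    intro y hy hyB
    obtain ⟨a, ha, rfl⟩ := Finset.mem_map.1 hy
    have := g.injective (hg _ hyB)
    simp only [coe_toEmbedding] at this hyB
    rw [this] at hyB
    exact hA ha hyB
  let E : A ≃ (A.map g.toEmbedding : Finset X) :=
    ⟨fun a => ⟨g a, Finset.mem_map.2 ⟨a, a.2, rfl⟩⟩, fun a => ⟨g⁻¹ a, by
      obtain ⟨b, hb, h⟩ := Finset.mem_map.1 a.2
      rw [← h]; simpa using hb⟩, fun a => by simp, fun a => by simp⟩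
  rw [orbitSum, orbitSum, Finset.smul_sum]
  refine Fintype.sum_equiv (Equiv.equivCongr (Equiv.refl T) E) _ _ fun e => ?_
  rw [smul_smul]
  have h1 := extPerm_spec hT hA e
  have h2 := extPerm_spec hT hA' (Equiv.equivCongr (Equiv.refl T) E e)
  refine hx.smul_eq fun t ht => ?_
  rcases ht with ht | ht
  · rw [h2.2 ⟨t, ht⟩, Perm.mul_apply, h1.2 ⟨t, ht⟩]
    rfl
  · rw [h2.1 t ht, Perm.mul_apply, h1.1 t ht, hg t ht]

end PermSupports

/-! ### Independence of characters. -/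

section Characters

open MulAction Equiv
open scoped Classical

variable {X : Type*} {L : Type*} [Field L] [MulSemiringAction (Perm X) L]

/-- The elements of `L` that are supported by `S`. -/
def supportedBy (X L : Type*) [Field L] [MulSemiringAction (Perm X) L] (S : Set X) :
    Submonoid L where
  carrier := {c | Supports (Perm X) S c}
  one_mem' := fun g _ => smul_one g
  mul_mem' := fun ha hb g hg => by rw [smul_mul', ha g hg, hb g hg]

/-- The action of `Perm X` on `L` moves points supported by single elements of `X`. -/
def SeparatesPoints (X L : Type*) [Field L] [MulSemiringAction (Perm X) L] : Prop :=
  ∀ s t : X, s ≠ t → ∃ y : L, Supports (Perm X) {t} y ∧ swap t s • y ≠ y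

/-- Artin's independence of characters, for the restrictions of permutations. -/
theorem linearIndependent_perm_smul (hL : SeparatesPoints X L) {ι : Type*} (g : ι → Perm X)
    (S : Set X) (hg : ∀ i j, i ≠ j → ∃ t ∈ S, g i t ≠ g j t) :
    LinearIndependent L (fun i => fun c : supportedBy X L S => g i • (c : L)) := by
  let χ : ι → (supportedBy X L S →* L) := fun i =>
    { toFun := fun c => g i • (c : L)
      map_one' := smul_one _
      map_mul' := fun a b => smul_mul' _ _ _ }
  have hχ : Function.Injective χ := by
    intro i j hij
    by_contra hne
    obtain ⟨t, htS, ht⟩ := hg i j hne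
    -- If the two characters agreed, `(g i)⁻¹ * g j` would fix `y`; on the support `{t}` it acts as
    -- the transposition that moves `y`.
    obtain ⟨y, hy, hyt⟩ := hL ((g i)⁻¹ (g j t)) t (fun h => ht (by
      rw [Perm.inv_eq_iff_eq] at h; exact h.symm))
    have h1 : g i • y = g j • y :=
      DFunLike.congr_fun hij ⟨y, hy.mono (by simpa using htS)⟩
    apply hyt
    have h2 : swap t ((g i)⁻¹ (g j t)) • y = ((g i)⁻¹ * g j) • y := hy.smul_eq fun x hx => by
      obtain rfl : x = t := hx
      simp
    rw [h2, mul_smul, ← h1, inv_smul_smul]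
  exact (linearIndependent_monoidHom (supportedBy X L S) L).comp χ hχ

end Characters

/-! ### Functionals with prescribed values. -/

section LinearAlgebra

/-- Values compatible with all linear relations define a functional on the span of the `v i`, and
over a field it extends to `V`. -/
theorem exists_linearMap_apply_eq {ι L V : Type*} [Field L] [AddCommGroup V] [Module L V]
    (v : ι → V) (u : ι → L) (h : ∀ f : ι →₀ L, Finsupp.linearCombination L v f = 0 →
      Finsupp.linearCombination L u f = 0) : ∃ ψ : V →ₗ[L] L, ∀ i, ψ (v i) = u i := by
  let F := Finsupp.linearCombination L v
  obtain ⟨ψ, hψ⟩ := LinearMap.exists_extend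
    (((LinearMap.ker F).liftQ (Finsupp.linearCombination L u) h).comp
      F.quotKerEquivRange.symm.toLinearMap)
  refine ⟨ψ, fun i => ?_⟩
  have h1 : F (Finsupp.single i 1) = v i := by simp [F]
  have := LinearMap.congr_fun hψ ⟨v i, ⟨Finsupp.single i 1, h1⟩⟩
  simp only [LinearMap.comp_apply, Submodule.subtype_apply] at this
  rw [this]
  have h2 : F.quotKerEquivRange.symm ⟨v i, ⟨Finsupp.single i 1, h1⟩⟩ =
      (LinearMap.ker F).mkQ (Finsupp.single i 1) := by
    rw [LinearEquiv.symm_apply_eq]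
    exact Subtype.ext h1.symm
  simp only [LinearEquiv.coe_coe, h2]
  exact (Submodule.liftQ_apply _ _ _).trans (by simp)

end LinearAlgebra

/-! ### Finitely generated representations: separation over a finite set. -/

section Shift

open MulAction Equiv
open scoped Classical

variable {X : Type*} {L : Type*} [Field L] [MulSemiringAction (Perm X) L]
  {V : Type*} [AddCommGroup V] [Module L V] [DistribMulAction (Perm X) V]

theorem map_smul_of_mem_span (hV : ∀ (g : Perm X) (a : L) (x : V), g • (a • x) = (g • a) • (g • x))
    (φ : V →ₗ[L] L) (g : Perm X) (S : Set V) (h : ∀ s ∈ S, φ (g • s) = g • φ s) :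
    ∀ x ∈ Submodule.span L S, φ (g • x) = g • φ x := by
  intro x hx
  induction hx using Submodule.span_induction with
  | mem x hx => exact h x hx
  | zero => simp
  | add x y _ _ hx hy => rw [smul_add, map_add, map_add, hx, hy, smul_add]
  | smul a x _ hx => rw [hV, LinearMap.map_smul, LinearMap.map_smul, hx, smul_eq_mul, smul_eq_mul, smul_mul']

/-- The indices of the vectors `p.2 A` for `p ∈ 𝒮` and the `p.1`-element sets `A` off `B`. -/
def genIndex (B : Finset X) (𝒮 : Finset (ℕ × (Finset X → V))) :
    Set ((ℕ × (Finset X → V)) × Finset X) :=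
  {q | q.1 ∈ 𝒮 ∧ q.2.card = q.1.1 ∧ Disjoint q.2 B}

/-- The span of the vectors `p.2 A` for `p ∈ 𝒮` and the `p.1`-element sets `A` off `B`. -/
def genSpan (L : Type*) [Field L] [Module L V] (B : Finset X)
    (𝒮 : Finset (ℕ × (Finset X → V))) : Submodule L V :=
  Submodule.span L ((fun q => q.1.2 q.2) '' genIndex B 𝒮)

/-- The functionals on `V` that are equivariant on `W` under the pointwise stabilizer of `C`
separate the points of `W`. -/
def SeparatedOver (C : Finset X) (W : Submodule L V) : Prop :=
  ∀ x ∈ W, x ≠ 0 → ∃ φ : V →ₗ[L] L, φ x ≠ 0 ∧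
    ∀ g : Perm X, (∀ c ∈ C, g c = c) → ∀ w ∈ W, φ (g • w) = g • φ w

theorem SeparatedOver.mono {C : Finset X} {W W' : Submodule L V} (h : SeparatedOver C W')
    (hW : W ≤ W') : SeparatedOver C W := fun x hx hx0 => by
  obtain ⟨φ, hφ, hφ'⟩ := h x (hW hx) hx0
  exact ⟨φ, hφ, fun g hg w hw => hφ' g hg w (hW hw)⟩

/-- The family `𝒮` is equivariant under the pointwise stabilizer of `B`. -/
def EquivariantFamily (B : Finset X) (𝒮 : Finset (ℕ × (Finset X → V))) : Prop :=
  ∀ p ∈ 𝒮, ∀ g : Perm X, (∀ b ∈ B, g b = b) → ∀ A, g • p.2 A = p.2 (A.map g.toEmbedding)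

theorem disjoint_map_perm {A B : Finset X} (h : Disjoint A B) {g : Perm X}
    (hg : ∀ b ∈ B, g b = b) : Disjoint (A.map g.toEmbedding) B := by
  rw [Finset.disjoint_left] at h ⊢
  intro y hy hyB
  obtain ⟨a, ha, rfl⟩ := Finset.mem_map.1 hy
  have := g.injective (hg _ hyB)
  simp only [coe_toEmbedding] at this hyB
  rw [this] at hyB
  exact h ha hyB

/-- The vectors obtained from `𝒮` by splitting off the points of `C`. -/
noncomputable def splitFamily {W : Type*} (C : Finset X) (p₀ : ℕ × (Finset X → W))
    (𝒮 : Finset (ℕ × (Finset X → W))) : Finset (ℕ × (Finset X → W)) :=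
  -- Omitting `(p₀, ∅)` is the gain: the vectors of `p₀` at sets off `C` become redundant, and any
  -- nonempty part split off lowers the degree.
  ((𝒮 ×ˢ C.powerset).filter fun r => r.2.card ≤ r.1.1 ∧ ¬ (r.1 = p₀ ∧ r.2 = ∅)).image
    fun r => (r.1.1 - r.2.card, fun A => r.1.2 (r.2 ∪ A))

theorem mem_splitFamily {W : Type*} {C : Finset X} {p₀ : ℕ × (Finset X → W)}
    {𝒮 : Finset (ℕ × (Finset X → W))} {p' : ℕ × (Finset X → W)} :
    p' ∈ splitFamily C p₀ 𝒮 ↔ ∃ p ∈ 𝒮, ∃ D ⊆ C, D.card ≤ p.1 ∧ ¬ (p = p₀ ∧ D = ∅) ∧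
      p' = (p.1 - D.card, fun A => p.2 (D ∪ A)) := by
  simp only [splitFamily, Finset.mem_image, Finset.mem_filter, Finset.mem_product,
    Finset.mem_powerset]
  constructor
  · rintro ⟨⟨p, D⟩, ⟨⟨h1, h2⟩, h3, h4⟩, h5⟩
    exact ⟨p, h1, D, h2, h3, h4, h5.symm⟩
  · rintro ⟨p, h1, D, h2, h3, h4, h5⟩
    exact ⟨⟨p, D⟩, ⟨⟨h1, h2⟩, h3, h4⟩, h5.symm⟩

theorem EquivariantFamily.splitFamily {B C : Finset X} (hBC : B ⊆ C) (p₀ : ℕ × (Finset X → V))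
    {𝒮 : Finset (ℕ × (Finset X → V))} (h : EquivariantFamily B 𝒮) :
    EquivariantFamily C (splitFamily C p₀ 𝒮) := by
  intro p' hp' g hg A
  obtain ⟨p, hp, D, hD, -, -, rfl⟩ := mem_splitFamily.1 hp'
  simp only
  rw [h p hp g (fun b hb => hg b (hBC hb)), Finset.map_union]
  suffices hDg : D.map g.toEmbedding = D by rw [hDg]
  ext x
  simp only [Finset.mem_map, coe_toEmbedding]
  constructor
  · rintro ⟨a, ha, rfl⟩
    rwa [hg a (hD ha)]
  · exact fun hx => ⟨x, hx, hg x (hD hx)⟩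

/-- A single relation for `p₀` at `A₀` gives, by translation, one at every index set off `C`, since
such a set is the image of `A₀` under a permutation fixing `C \ A₀`. The translated relation uses
only other members of the family or sets that meet `C`. -/
theorem genSpan_le_splitFamily
    (hV : ∀ (g : Perm X) (a : L) (x : V), g • (a • x) = (g • a) • (g • x))
    {B : Finset X} {𝒮 : Finset (ℕ × (Finset X → V))} (h𝒮 : EquivariantFamily B 𝒮)
    {q₀ : (ℕ × (Finset X → V)) × Finset X} (hq₀ : q₀ ∈ genIndex B 𝒮)
    (hmem : q₀.1.2 q₀.2 ∈ Submodule.span L ((fun q => q.1.2 q.2) '' (genIndex B 𝒮 \ {q₀}))) :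
    ∃ C : Finset X, B ⊆ C ∧ genSpan L B 𝒮 ≤ genSpan L C (splitFamily C q₀.1 𝒮) := by
  obtain ⟨l, hl, hlq⟩ := (Finsupp.mem_span_image_iff_linearCombination L).1 hmem
  obtain ⟨p₀, A₀⟩ := q₀
  -- `C` contains every index set occurring in the relation.
  let C : Finset X := B ∪ A₀ ∪ l.support.biUnion fun q => q.2
  have hBC : B ⊆ C := fun x hx => by simp [C, hx]
  have hAC : A₀ ⊆ C := fun x hx => by simp [C, hx]
  have hlC : ∀ q ∈ l.support, q.2 ⊆ C := fun q hq x hx => by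
    simp only [C, Finset.mem_union, Finset.mem_biUnion]
    exact Or.inr ⟨q, hq, hx⟩
  refine ⟨C, hBC, ?_⟩
  have step : ∀ q ∈ genIndex B 𝒮, ¬ (q.1 = p₀ ∧ q.2 ∩ C = ∅) →
      q.1.2 q.2 ∈ genSpan L C (splitFamily C p₀ 𝒮) := by
    intro q hq hne
    refine Submodule.subset_span ⟨((q.1.1 - (q.2 ∩ C).card, fun A => q.1.2 (q.2 ∩ C ∪ A)),
      q.2 \ C), ⟨?_, ?_, ?_⟩, ?_⟩
    · refine mem_splitFamily.2 ⟨q.1, hq.1, q.2 ∩ C, Finset.inter_subset_right, ?_, hne, rfl⟩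
      rw [← hq.2.1]
      exact Finset.card_le_card Finset.inter_subset_left
    · simp only
      rw [← hq.2.1, ← Finset.card_inter_add_card_sdiff q.2 C]
      omega
    · exact Finset.sdiff_disjoint
    · simp only
      rw [Finset.union_comm, Finset.sdiff_union_inter]
  refine Submodule.span_le.2 ?_
  rintro _ ⟨q, hq, rfl⟩
  by_cases hqp : q.1 = p₀ ∧ q.2 ∩ C = ∅
  swap
  · exact step q hq hqp
  obtain ⟨p, A⟩ := q
  obtain ⟨rfl, hA⟩ := hqp
  simp only at hA hmem hlq hl
  have hcard : A.card = A₀.card := hq.2.1.trans hq₀.2.1.symm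
  let e : A₀ ≃ A := Finset.equivOfCardEq hcard.symm
  have hAC' : Disjoint A (C \ A₀) := by
    rw [← Finset.disjoint_iff_inter_eq_empty] at hA
    exact hA.mono_right Finset.sdiff_subset
  obtain ⟨hg, hge⟩ := extPerm_spec (B := C \ A₀) Finset.disjoint_sdiff hAC' e
  set g := extPerm (C \ A₀) e
  have hgB : ∀ b ∈ B, g b = b := fun b hb => hg b (by
    rw [Finset.mem_sdiff]
    exact ⟨hBC hb, fun h => Finset.disjoint_left.1 hq₀.2.2 h hb⟩)
  have hgA : A₀.map g.toEmbedding = A := by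
    refine Finset.eq_of_subset_of_card_le ?_ (by rw [Finset.card_map, hcard])
    intro x hx
    obtain ⟨a, ha, rfl⟩ := Finset.mem_map.1 hx
    rw [coe_toEmbedding, hge ⟨a, ha⟩]
    exact (e ⟨a, ha⟩).2
  have hgp : p.2 A = g • p.2 A₀ := by rw [h𝒮 p hq.1 g hgB, hgA]
  simp only [SetLike.mem_coe]
  rw [hgp, ← hlq, Finsupp.linearCombination_apply, Finsupp.sum, Finset.smul_sum]
  refine Submodule.sum_mem _ fun r hr => ?_
  have hrm : r ∈ genIndex B 𝒮 \ {(p, A₀)} := (Finsupp.mem_supported L l).1 hl hr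
  rw [hV, h𝒮 r.1 hrm.1.1 g hgB]
  refine Submodule.smul_mem _ _
    (step (r.1, r.2.map g.toEmbedding) ⟨hrm.1.1, ?_, disjoint_map_perm hrm.1.2.2 hgB⟩ ?_)
  · simpa using hrm.1.2.1
  · rintro ⟨hrp, hri⟩
    simp only at hrp hri
    have hrA : r.2 ≠ A₀ := fun h => hrm.2 (Prod.ext hrp h)
    have hrcard : r.2.card = A₀.card := by rw [hrm.1.2.1, hrp, hq₀.2.1]
    -- A term with the same `p` has an index set of the same size as `A₀` but different from it. Its
    -- point outside `A₀` lies in `C` and is fixed by `g`, so the translated set still meets `C`.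
    obtain ⟨t, htr, htA⟩ : ∃ t ∈ r.2, t ∉ A₀ := by
      by_contra hcon
      push Not at hcon
      exact hrA (Finset.eq_of_subset_of_card_le hcon hrcard.ge)
    have htC : t ∈ C := hlC r hr htr
    have hgt : g t = t := hg t (Finset.mem_sdiff.2 ⟨htC, htA⟩)
    have : t ∈ r.2.map g.toEmbedding ∩ C :=
      Finset.mem_inter.2 ⟨Finset.mem_map.2 ⟨t, htr, hgt⟩, htC⟩
    rw [hri] at this
    exact absurd this (Finset.notMem_empty t)

/-- All bijections from `A₀` to the members of `𝒜` have different restrictions to `A₀`, hence are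
independent as functions of `c`. If the sums vanished for all `c`, the coefficient `f A₀` of the
identity of `A₀` would be zero. -/
theorem exists_orbitSum_ne_zero (hL : SeparatesPoints X L) {B A₀ : Finset X}
    (hA₀ : Disjoint A₀ B) (𝒜 : Finset (Finset X)) (h𝒜 : ∀ A ∈ 𝒜, Disjoint A B)
    (f : Finset X → L) (hmem : A₀ ∈ 𝒜) (hf : f A₀ ≠ 0) :
    ∃ c : L, Supports (Perm X) ((A₀ : Set X) ∪ B) c ∧
      ∑ A ∈ 𝒜, f A * orbitSum B A₀ c A ≠ 0 := by
  by_contra hcon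
  push Not at hcon
  let ι := Σ A : 𝒜, (A₀ ≃ A.1)
  have hlin := linearIndependent_perm_smul (ι := ι) hL (fun i => extPerm B i.2)
    ((A₀ : Set X) ∪ B) (by
      rintro ⟨⟨A, hA⟩, e⟩ ⟨⟨A', hA'⟩, e'⟩ hne
      by_contra hall
      push Not at hall
      have h1 := (extPerm_spec hA₀ (h𝒜 A hA) e).2
      have h2 := (extPerm_spec hA₀ (h𝒜 A' hA') e').2
      have hee : ∀ t : A₀, (e t : X) = e' t := fun t => by
        rw [← h1 t, ← h2 t]
        exact hall t (Or.inl t.2)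
      have hAA : A = A' := by
        ext x
        constructor
        · intro hx
          have := hee (e.symm ⟨x, hx⟩)
          rw [apply_symm_apply] at this
          exact (show x = _ from this) ▸ (e' _).2
        · intro hx
          have := hee (e'.symm ⟨x, hx⟩)
          rw [apply_symm_apply] at this
          exact (show _ = x from this) ▸ (e _).2
      subst hAA
      exact hne (by
        congr 1
        ext t
        exact hee t))
  rw [Fintype.linearIndependent_iff] at hlin
  have := hlin (fun i => f i.1.1) (by
    ext ⟨c, hc⟩
    have := hcon c hc
    rw [← Finset.sum_coe_sort] at this
    simp only [Finset.sum_apply, Pi.smul_apply, smul_eq_mul, Pi.zero_apply]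
    rw [← this, Fintype.sum_sigma]
    refine Finset.sum_congr rfl fun A _ => ?_
    rw [orbitSum, Finset.mul_sum]) ⟨⟨A₀, hmem⟩, Equiv.refl _⟩
  exact hf this

end Shift

section Shift

open MulAction Equiv
open scoped Classical

variable {X : Type*} {L : Type*} [Field L] [MulSemiringAction (Perm X) L]
  {V : Type*} [AddCommGroup V] [Module L V] [DistribMulAction (Perm X) V]

/-- No relation involves a generator of degree `n`, so values on these can be chosen freely. If `x`
has a nonzero top coefficient, orbit sums on one family and zero elsewhere detect it. Otherwise `x`
lies in the lower span, and a functional from there is extended by zero on the top generators. -/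
theorem separatedOver_of_independent_top (hL : SeparatesPoints X L)
    (hV : ∀ (g : Perm X) (a : L) (x : V), g • (a • x) = (g • a) • (g • x))
    {n : ℕ} {B C : Finset X} {𝒮 : Finset (ℕ × (Finset X → V))} (hn : ∀ p ∈ 𝒮, p.1 ≤ n)
    (h𝒮 : EquivariantFamily B 𝒮)
    (hind : ∀ q₀ ∈ genIndex B 𝒮, q₀.1.1 = n →
      q₀.1.2 q₀.2 ∉ Submodule.span L ((fun q => q.1.2 q.2) '' (genIndex B 𝒮 \ {q₀})))
    (hBC : B ⊆ C) (hlow : SeparatedOver C (genSpan L B (𝒮.filter fun p => p.1 < n))) :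
    SeparatedOver C (genSpan L B 𝒮) := by
  let ι := genIndex B 𝒮
  let vec : ι → V := fun q => q.1.1.2 q.1.2
  have hspan : genSpan L B 𝒮 = Submodule.span L (Set.range vec) := by
    rw [genSpan, Set.image_eq_range]
  have hker : ∀ f : ι →₀ L, Finsupp.linearCombination L vec f = 0 →
      ∀ q : ι, q.1.1.1 = n → f q = 0 := by
    intro f hf q hq
    by_contra hne
    apply hind q.1 q.2 hq
    have h1 : f q • vec q = - Finsupp.linearCombination L vec (f.erase q) := by
      rw [eq_neg_iff_add_eq_zero, ← hf, ← Finsupp.single_add_erase q f, map_add,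
        Finsupp.linearCombination_single]
      simp
    have h2 : vec q = (f q)⁻¹ • (f q • vec q) := by rw [smul_smul, inv_mul_cancel₀ hne, one_smul]
    change vec q ∈ _
    rw [h2, h1]
    refine Submodule.smul_mem _ _ (Submodule.neg_mem _ ?_)
    rw [Finsupp.linearCombination_apply, Finsupp.sum]
    refine Submodule.sum_mem _ fun r hr => Submodule.smul_mem _ _ (Submodule.subset_span ?_)
    refine ⟨r.1, ⟨r.2, fun h => ?_⟩, rfl⟩
    rw [Subtype.ext h, Finsupp.support_erase] at hr
    exact Finset.notMem_erase _ _ hr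
  -- Values on the generators that respect the relations and the stabilizer of `C` give an
  -- admissible functional.
  have mk : ∀ u : ι → L, (∀ f : ι →₀ L, Finsupp.linearCombination L vec f = 0 →
      Finsupp.linearCombination L u f = 0) → (∀ g : Perm X, (∀ c ∈ C, g c = c) → ∀ q q' : ι,
        q'.1 = (q.1.1, q.1.2.map g.toEmbedding) → u q' = g • u q) →
      ∃ ψ : V →ₗ[L] L, (∀ f : ι →₀ L, ψ (Finsupp.linearCombination L vec f) =
        Finsupp.linearCombination L u f) ∧
        ∀ g : Perm X, (∀ c ∈ C, g c = c) → ∀ w ∈ genSpan L B 𝒮, ψ (g • w) = g • ψ w := by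
    intro u hu hug
    obtain ⟨ψ, hψ⟩ := exists_linearMap_apply_eq vec u hu
    refine ⟨ψ, fun f => ?_, fun g hg => ?_⟩
    · rw [Finsupp.linearCombination_apply, Finsupp.linearCombination_apply, Finsupp.sum,
        Finsupp.sum, map_sum]
      exact Finset.sum_congr rfl fun q _ => by rw [map_smul, hψ]
    · rw [hspan]
      refine map_smul_of_mem_span hV ψ g _ ?_
      rintro _ ⟨q, rfl⟩
      have hgB : ∀ b ∈ B, g b = b := fun b hb => hg b (hBC hb)
      let q' : ι := ⟨(q.1.1, q.1.2.map g.toEmbedding),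
        q.2.1, by simpa using q.2.2.1, disjoint_map_perm q.2.2.2 hgB⟩
      have : g • vec q = vec q' := h𝒮 _ q.2.1 g hgB _
      rw [this, hψ, hψ, hug g hg q q' rfl]
  intro x hx hx0
  rw [hspan, ← Finsupp.range_linearCombination] at hx
  obtain ⟨f, rfl⟩ := hx
  by_cases htop : ∃ q : ι, q.1.1.1 = n ∧ f q ≠ 0
  · obtain ⟨q₀, hq₀, hfq₀⟩ := htop
    obtain ⟨⟨p₀, A₀⟩, hmem₀⟩ := q₀
    simp only at hq₀
    let S : Finset ι := f.support.filter fun q => q.1.1 = p₀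
    let F : Finset X → L := fun A => if h : (p₀, A) ∈ genIndex B 𝒮 then f ⟨(p₀, A), h⟩ else 0
    have hFq : ∀ q : ι, q.1.1 = p₀ → F q.1.2 = f q := by
      rintro ⟨⟨p, A⟩, h⟩ rfl
      exact dif_pos h
    obtain ⟨c, hc, hne⟩ := exists_orbitSum_ne_zero hL (hmem₀.2.2) (S.image fun q => q.1.2)
      (by
        intro A hA
        obtain ⟨q, -, rfl⟩ := Finset.mem_image.1 hA
        exact q.2.2.2) F
      (Finset.mem_image.2 ⟨⟨(p₀, A₀), hmem₀⟩, by simp [S, hfq₀], rfl⟩)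
      (by rw [hFq ⟨(p₀, A₀), hmem₀⟩ rfl]; exact hfq₀)
    obtain ⟨ψ, hψ, hψg⟩ := mk (fun q => if q.1.1 = p₀ then orbitSum B A₀ c q.1.2 else 0) (by
        intro f' hf'
        rw [Finsupp.linearCombination_apply, Finsupp.sum]
        refine Finset.sum_eq_zero fun q _ => ?_
        by_cases hq : q.1.1 = p₀
        · rw [hker f' hf' q (by rw [hq, hq₀]), zero_smul]
        · rw [if_neg hq, smul_zero]) (by
        intro g hg q q' hqq
        rw [hqq]
        simp only
        split_ifs
        · rw [smul_orbitSum hc hmem₀.2.2 q.2.2.2 fun b hb => hg b (hBC hb)]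
        · rw [smul_zero])
    refine ⟨ψ, ?_, hψg⟩
    rw [hψ]
    convert hne using 1
    rw [Finset.sum_image, Finsupp.linearCombination_apply, Finsupp.sum, Finset.sum_filter]
    · refine Finset.sum_congr rfl fun q _ => ?_
      split_ifs with h
      · rw [hFq q h, smul_eq_mul]
      · rw [smul_zero]
    · intro q hq q' hq' h
      refine Subtype.ext (Prod.ext ?_ h)
      rw [(Finset.mem_filter.1 hq).2, (Finset.mem_filter.1 hq').2]
  · push Not at htop
    have hsum : ∀ f : ι →₀ L, (∀ q : ι, q.1.1.1 = n → f q = 0) → ∀ q ∈ f.support, q.1.1.1 < n :=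
      fun f hf q hq => lt_of_le_of_ne (hn _ q.2.1)
        fun h => (Finsupp.mem_support_iff.1 hq) (hf q h)
    have hvlow : ∀ q : ι, q.1.1.1 < n → vec q ∈ genSpan L B (𝒮.filter fun p => p.1 < n) :=
      fun q hq => Submodule.subset_span
        ⟨q.1, ⟨Finset.mem_filter.2 ⟨q.2.1, hq⟩, q.2.2⟩, rfl⟩
    obtain ⟨φ, hφ, hφg⟩ := hlow (Finsupp.linearCombination L vec f) (by
      rw [Finsupp.linearCombination_apply, Finsupp.sum]
      exact Submodule.sum_mem _ fun q hq =>
        Submodule.smul_mem _ _ (hvlow q (hsum f htop q hq))) hx0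
    let u : ι → L := fun q => if q.1.1.1 < n then φ (vec q) else 0
    have hu : ∀ f : ι →₀ L, (∀ q : ι, q.1.1.1 = n → f q = 0) →
        Finsupp.linearCombination L u f = φ (Finsupp.linearCombination L vec f) := by
      intro f hf
      rw [Finsupp.linearCombination_apply, Finsupp.linearCombination_apply, Finsupp.sum,
        Finsupp.sum, map_sum]
      refine Finset.sum_congr rfl fun q hq => ?_
      simp only [u]
      rw [if_pos (hsum f hf q hq), map_smul]
    obtain ⟨ψ, hψ, hψg⟩ := mk u (fun f' hf' => by
        rw [hu f' (hker f' hf'), hf', map_zero]) (by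
        intro g hg q q' hqq
        have h1 : vec q' = g • vec q := by
          simp only [vec]
          rw [hqq, h𝒮 _ q.2.1 g fun b hb => hg b (hBC hb)]
        have h2 : q'.1.1.1 = q.1.1.1 := by rw [hqq]
        simp only [u]
        rw [h1, h2]
        split_ifs with h
        · exact hφg g hg _ (hvlow q h)
        · rw [smul_zero])
    refine ⟨ψ, ?_, hψg⟩
    rw [hψ, hu f htop]
    exact hφ

theorem SeparatedOver.mono_left {C C' : Finset X} {W : Submodule L V} (h : SeparatedOver C W)
    (hC : C ⊆ C') : SeparatedOver C' W := fun x hx hx0 => by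
  obtain ⟨φ, hφ, hφ'⟩ := h x hx hx0
  exact ⟨φ, hφ, fun g hg => hφ' g fun c hc => hg c (hC hc)⟩

/-- Double induction: on the bound for the degrees, then on the number of families of top degree. A
dependence in top degree removes a top family at the cost of enlarging the fixed set; if there is
none, only the lower span remains to be treated. -/
theorem exists_separatedOver_genSpan (hL : SeparatesPoints X L)
    (hV : ∀ (g : Perm X) (a : L) (x : V), g • (a • x) = (g • a) • (g • x)) (n : ℕ) :
    ∀ (B : Finset X) (𝒮 : Finset (ℕ × (Finset X → V))), (∀ p ∈ 𝒮, p.1 < n) →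
      EquivariantFamily B 𝒮 → ∃ C : Finset X, SeparatedOver C (genSpan L B 𝒮) := by
  induction n with
  | zero =>
    intro B 𝒮 h _
    refine ⟨∅, fun x hx hx0 => (hx0 ?_).elim⟩
    have : genIndex B 𝒮 = ∅ := by
      ext q
      simp only [Set.mem_empty_iff_false, iff_false]
      exact fun hq => absurd (h _ hq.1) (by omega)
    rw [genSpan, this, Set.image_empty, Submodule.span_empty] at hx
    exact (Submodule.mem_bot L).1 hx
  | succ n ihn =>
    suffices H : ∀ (m : ℕ) (B : Finset X) (𝒮 : Finset (ℕ × (Finset X → V))),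
        (𝒮.filter fun p => p.1 = n).card = m → (∀ p ∈ 𝒮, p.1 < n + 1) →
        EquivariantFamily B 𝒮 → ∃ C : Finset X, SeparatedOver C (genSpan L B 𝒮) from
      fun B 𝒮 h1 h2 => H _ B 𝒮 rfl h1 h2
    intro m
    induction m using Nat.strong_induction_on with
    | _ m ihm =>
    intro B 𝒮 hm hn h𝒮
    by_cases hdep : ∃ q₀ ∈ genIndex B 𝒮, q₀.1.1 = n ∧
        q₀.1.2 q₀.2 ∈ Submodule.span L ((fun q => q.1.2 q.2) '' (genIndex B 𝒮 \ {q₀}))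
    · obtain ⟨q₀, hq₀, hqn, hmem⟩ := hdep
      obtain ⟨C, hBC, hle⟩ := genSpan_le_splitFamily hV h𝒮 hq₀ hmem
      obtain ⟨C', hC'⟩ := ihm _ (by
        rw [← hm]
        refine Finset.card_lt_card (Finset.ssubset_of_subset_of_ssubset (s₂ := (𝒮.filter
          fun p => p.1 = n).erase q₀.1) ?_ (Finset.erase_ssubset ?_))
        · intro p' hp'
          obtain ⟨h1, h2⟩ := Finset.mem_filter.1 hp'
          obtain ⟨p, hp, D, -, hDp, hne, rfl⟩ := mem_splitFamily.1 h1
          simp only at h2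
          have hp1 := hn p hp
          -- Since `p.1 ≤ n`, a member of degree `n` can only come from `D = ∅`. When `n = 0` the
          -- subtraction is truncated, and the bound `D.card ≤ p.1` is what excludes larger `D`.
          have hD : D = ∅ := by
            rw [← Finset.card_eq_zero]
            omega
          subst hD
          have : ((p.1 - (∅ : Finset X).card, fun A => p.2 (∅ ∪ A)) : ℕ × (Finset X → V)) = p := by
            simp
          rw [this, Finset.mem_erase, Finset.mem_filter]
          refine ⟨fun h => hne ⟨h, rfl⟩, hp, ?_⟩
          simpa using h2
        · exact Finset.mem_filter.2 ⟨hq₀.1, hqn⟩) C (splitFamily C q₀.1 𝒮) rfl (by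
        intro p' hp'
        obtain ⟨p, hp, D, -, -, -, rfl⟩ := mem_splitFamily.1 hp'
        exact lt_of_le_of_lt (Nat.sub_le _ _) (hn p hp)) (h𝒮.splitFamily hBC _)
      exact ⟨C', hC'.mono hle⟩
    · push Not at hdep
      obtain ⟨C, hC⟩ := ihn B (𝒮.filter fun p => p.1 < n)
        (fun p hp => (Finset.mem_filter.1 hp).2)
        (fun p hp => h𝒮 p (Finset.mem_filter.1 hp).1)
      exact ⟨B ∪ C, separatedOver_of_independent_top hL hV (fun p hp => Nat.lt_succ_iff.1 (hn p hp))
        h𝒮 hdep Finset.subset_union_left (hC.mono_left Finset.subset_union_right)⟩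

/-- A form of Hilbert's Theorem 90. -/
theorem mem_span_orbitSum (hL : SeparatesPoints X L)
    (hV : ∀ (g : Perm X) (a : L) (x : V), g • (a • x) = (g • a) • (g • x))
    {T : Finset X} {x : V} (hx : Supports (Perm X) (T : Set X) x) :
    x ∈ Submodule.span L ((fun c : L => orbitSum ∅ T (c • x) T) ''
      {c | Supports (Perm X) (T : Set X) c}) := by
  by_contra hcon
  -- A functional `ℓ` that kills all the orbit sums gives `∑ ℓ(e x) · e(c) = 0` for every `c`
  -- supported by `T`. Independence forces each `ℓ(e x) = 0`, in particular `ℓ x = 0`.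
  obtain ⟨ℓ, hℓx, hℓ⟩ := Submodule.exists_le_ker_of_notMem hcon
  have hTe : Disjoint T (∅ : Finset X) := Finset.disjoint_empty_right T
  have hlin := linearIndependent_perm_smul (ι := T ≃ T) hL (fun e => extPerm ∅ e)
    (T : Set X) (by
      intro e e' hne
      by_contra hall
      push Not at hall
      apply hne
      ext t
      have := hall t t.2
      rwa [(extPerm_spec hTe hTe e).2, (extPerm_spec hTe hTe e').2] at this)
  rw [Fintype.linearIndependent_iff] at hlin
  have h1 := hlin (fun e => ℓ (extPerm ∅ e • x)) (by
    ext ⟨c, hc⟩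
    have := hℓ (Submodule.subset_span ⟨c, hc, rfl⟩)
    rw [LinearMap.mem_ker] at this
    simp only [orbitSum, map_sum] at this
    simp only [Finset.sum_apply, Pi.smul_apply, smul_eq_mul, Pi.zero_apply]
    rw [← this]
    refine Finset.sum_congr rfl fun e _ => ?_
    rw [hV, LinearMap.map_smul, smul_eq_mul, mul_comm]) (Equiv.refl T)
  have h2 : extPerm ∅ (Equiv.refl T) • x = x :=
    hx _ fun t ht => (extPerm_spec hTe hTe (Equiv.refl T)).2 ⟨t, ht⟩
  rw [h2] at h1
  exact hℓx h1

theorem smul_mem_span (hV : ∀ (g : Perm X) (a : L) (x : V), g • (a • x) = (g • a) • (g • x))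
    {S : Set V} (g : Perm X) (h : ∀ s ∈ S, g • s ∈ Submodule.span L S) :
    ∀ x ∈ Submodule.span L S, g • x ∈ Submodule.span L S := by
  intro x hx
  induction hx using Submodule.span_induction with
  | mem x hx => exact h x hx
  | zero => simp
  | add x y _ _ hx hy => rw [smul_add]; exact Submodule.add_mem _ hx hy
  | smul a x _ hx => rw [hV]; exact Submodule.smul_mem _ _ hx

/-- The subrepresentation generated by `Y`. -/
def orbitSpan (X L : Type*) {V : Type*} [Field L] [AddCommGroup V] [Module L V]
    [DistribMulAction (Perm X) V] (Y : Set V) : Submodule L V :=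
  Submodule.span L {z | ∃ g : Perm X, ∃ y ∈ Y, z = g • y}

/-- Hilbert 90 expresses each generator through finitely many orbit sums. As functions of the target
set these form a family equivariant under all permutations, so the induction can start with `B = ∅`.
-/
theorem exists_separatedOver_orbitSpan (hL : SeparatesPoints X L)
    (hV : ∀ (g : Perm X) (a : L) (x : V), g • (a • x) = (g • a) • (g • x))
    (Y : Finset V) (hY : ∀ y ∈ Y, FinSupported X y) :
    ∃ C : Finset X, SeparatedOver C (orbitSpan X L (Y : Set V)) := by
  have hfin : ∀ y : Y, ∃ (T : Finset X) (F : Finset L), Supports (Perm X) (T : Set X) y.1 ∧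
      (∀ c ∈ F, Supports (Perm X) (T : Set X) c) ∧
      y.1 ∈ Submodule.span L ((fun c : L => orbitSum ∅ T (c • y.1) T) '' (F : Set L)) := by
    intro y
    obtain ⟨T, hT⟩ := hY y y.2
    obtain ⟨R, hR, hyR⟩ := Submodule.mem_span_finite_of_mem_span (mem_span_orbitSum hL hV hT)
    obtain ⟨F, hF, rfl⟩ := Finset.subset_set_image_iff.1 hR
    exact ⟨T, F, hT, hF, by simpa using hyR⟩
  choose T F hT hF hmem using hfin
  let 𝒮 : Finset (ℕ × (Finset X → V)) := Finset.univ.biUnion fun y : Y =>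
    (F y).image fun c => ((T y).card, orbitSum ∅ (T y) (c • y.1))
  have h𝒮 : EquivariantFamily ∅ 𝒮 := by
    intro p hp g hg A
    obtain ⟨y, -, hp⟩ := Finset.mem_biUnion.1 hp
    obtain ⟨c, hc, rfl⟩ := Finset.mem_image.1 hp
    refine smul_orbitSum ?_ (Finset.disjoint_empty_right _) (Finset.disjoint_empty_right _) hg
    intro k hk
    have hk' : ∀ ⦃a⦄, a ∈ (T y : Set X) → k • a = a := fun a ha => hk (Or.inl ha)
    rw [hV, hF y c hc k hk', hT y k hk']
  obtain ⟨C, hC⟩ := exists_separatedOver_genSpan hL hV (𝒮.sup Prod.fst + 1) ∅ 𝒮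
    (fun p hp => Nat.lt_succ_iff.2 (Finset.le_sup (f := Prod.fst) hp)) h𝒮
  refine ⟨C, hC.mono (Submodule.span_le.2 ?_)⟩
  rintro _ ⟨g, y, hy, rfl⟩
  refine smul_mem_span hV g ?_ y ?_
  · rintro _ ⟨q, hq, rfl⟩
    simp only
    rw [h𝒮 _ hq.1 g (by simp)]
    exact Submodule.subset_span ⟨(q.1, q.2.map g.toEmbedding),
      ⟨hq.1, by simpa using hq.2.1, Finset.disjoint_empty_right _⟩, rfl⟩
  · refine Submodule.span_le.2 ?_ (hmem ⟨y, hy⟩)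
    rintro _ ⟨c, hc, rfl⟩
    refine Submodule.subset_span ⟨(((T ⟨y, hy⟩).card, orbitSum ∅ (T ⟨y, hy⟩) (c • y)),
      T ⟨y, hy⟩), ⟨?_, rfl, Finset.disjoint_empty_right _⟩, rfl⟩
    exact Finset.mem_biUnion.2 ⟨⟨y, hy⟩, Finset.mem_univ _, Finset.mem_image.2 ⟨c, hc, rfl⟩⟩

end Shift

/-! ### Specialization of linear relations. -/

section Specialization

/-- If `ε` and `η⁻¹` agree on the elements of the image of `ε` fixed by `H`, then linear relations
with coefficients `ε a` between elements fixed by `H` specialize. -/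
theorem sum_mul_eq_zero_of_fixed {L κ : Type*} [Field L] (ε η : L →+* L) (H : Set (L →+* L))
    (hH : ∀ p ∈ H, ∀ a, ∃ a', p (ε a) = ε a')
    (hη : ∀ a, (∀ p ∈ H, p (ε a) = ε a) → η (ε a) = a) (y : κ → L) (s : Finset κ) :
    ∀ a : κ → L, (∀ k ∈ s, ∀ p ∈ H, p (y k) = y k) → ∑ k ∈ s, ε (a k) * y k = 0 →
      ∑ k ∈ s, a k * η (y k) = 0 := by
  classical
  induction s using Finset.strongInduction with
  | H s ih =>
  intro a hy hsum
  by_cases ha : ∀ k ∈ s, a k = 0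
  · exact Finset.sum_eq_zero fun k hk => by rw [ha k hk, zero_mul]
  push Not at ha
  obtain ⟨k₁, hk₁, hak₁⟩ := ha
  -- Artin's descent: normalize one coefficient to `1`. If all coefficients are fixed by `H`, apply
  -- `η` to the relation; otherwise subtract the relation from its image under some `p ∈ H`.
  let b : κ → L := fun k => (a k₁)⁻¹ * a k
  have hb1 : b k₁ = 1 := inv_mul_cancel₀ hak₁
  have hbsum : ∑ k ∈ s, ε (b k) * y k = 0 := by
    simp only [b, map_mul, mul_assoc]
    rw [← Finset.mul_sum, hsum, mul_zero]
  suffices hb : ∑ k ∈ s, b k * η (y k) = 0 by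
    simp only [b, mul_assoc] at hb
    rw [← Finset.mul_sum] at hb
    exact (mul_eq_zero.1 hb).resolve_left (inv_ne_zero hak₁)
  by_cases hfix : ∀ k ∈ s, ∀ p ∈ H, p (ε (b k)) = ε (b k)
  · have : ∑ k ∈ s, b k * η (y k) = η (∑ k ∈ s, ε (b k) * y k) := by
      rw [map_sum]
      exact Finset.sum_congr rfl fun k hk => by rw [map_mul, hη _ (hfix k hk)]
    rw [this, hbsum, map_zero]
  push Not at hfix
  obtain ⟨k₂, hk₂, p, hp, hne⟩ := hfix
  choose b' hb' using fun k => hH p hp (b k)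
  let d : κ → L := fun k => b' k - b k
  have hd1 : d k₁ = 0 := by
    apply ε.injective
    rw [map_sub, ← hb', hb1]
    simp
  have hd2 : d k₂ ≠ 0 := by
    intro h
    apply hne
    rw [hb', sub_eq_zero.1 h]
  have hdsum : ∑ k ∈ s, ε (d k) * y k = 0 := by
    have h1 : ∑ k ∈ s, ε (b' k) * y k = p (∑ k ∈ s, ε (b k) * y k) := by
      rw [map_sum]
      exact Finset.sum_congr rfl fun k hk => by rw [map_mul, hb', hy k hk p hp]
    simp only [d, map_sub, sub_mul, Finset.sum_sub_distrib]
    rw [h1, hbsum, map_zero, sub_zero]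
  have hcut : ∀ (k₀ : κ) (c : κ → L), k₀ ∈ s → c k₀ = 0 → ∑ k ∈ s, ε (c k) * y k = 0 →
      ∑ k ∈ s, c k * η (y k) = 0 := by
    intro k₀ c hk₀ hc hcs
    rw [← Finset.sum_erase s (a := k₀) (by rw [hc, zero_mul])]
    refine ih _ (Finset.erase_ssubset hk₀) c (fun k hk => hy k (Finset.mem_of_mem_erase hk)) ?_
    rw [Finset.sum_erase s (by rw [hc, map_zero, zero_mul]), hcs]
  have hdη := hcut k₁ d hk₁ hd1 hdsum
  -- The difference `d` vanishes at `k₁`, and this combination vanishes at `k₂`. Both are shorter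
  -- relations, and the original is recovered from them.
  have hrη := hcut k₂ (fun k => b k - b k₂ / d k₂ * d k) hk₂ (by
    rw [div_mul_cancel₀ _ hd2, sub_self]) (by
    simp only [map_sub, sub_mul, Finset.sum_sub_distrib, map_mul, mul_assoc]
    rw [← Finset.mul_sum, hdsum, hbsum, mul_zero, sub_zero])
  simp only [sub_mul, Finset.sum_sub_distrib, mul_assoc] at hrη
  rwa [← Finset.mul_sum, hdη, mul_zero, sub_zero] at hrη

end Specialization

/-! ### Injections acting on smooth objects. -/

section EmbeddingAction

open MulAction Equiv
open scoped Classical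

variable {X : Type*} {Z : Type*} [MulAction (Perm X) Z]

/-- The action of injections on the finitely supported points. -/
noncomputable def embAct (e : X ↪ X) (z : Z) : Z :=
  if h : FinSupported X z then
    (exists_perm_eqOn h.choose e e.injective.injOn).choose • z else z

/-- The chosen support and permutation in `embAct` do not matter: both candidates are compared with
a permutation agreeing with `e` on the union of the two supports. -/
theorem embAct_eq {e : X ↪ X} {z : Z} {T : Finset X} (hT : Supports (Perm X) (T : Set X) z)
    {g : Perm X} (hg : ∀ t ∈ T, g t = e t) : embAct e z = g • z := by
  have h : FinSupported X z := ⟨T, hT⟩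
  rw [embAct, dif_pos h]
  have h1 := (exists_perm_eqOn h.choose e e.injective.injOn).choose_spec
  obtain ⟨k, hk⟩ := exists_perm_eqOn (T ∪ h.choose) e e.injective.injOn
  rw [h.choose_spec.smul_eq (g' := k) (fun x hx => by
      rw [h1 x hx, hk x (Finset.mem_union_right _ hx)]),
    hT.smul_eq (g' := k) (g := g) (fun x hx => by
      rw [hg x hx, hk x (Finset.mem_union_left _ hx)])]

theorem exists_embAct_eq (e : X ↪ X) {z : Z} (h : FinSupported X z) :
    ∃ T : Finset X, ∀ g : Perm X, (∀ t ∈ T, g t = e t) → embAct e z = g • z := by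
  obtain ⟨T, hT⟩ := h
  exact ⟨T, fun g hg => embAct_eq hT hg⟩

theorem exists_embAct_eq_smul (e : X ↪ X) {z : Z} (h : FinSupported X z) :
    ∃ g : Perm X, embAct e z = g • z := by
  obtain ⟨T, hT⟩ := exists_embAct_eq e h
  obtain ⟨g, hg⟩ := exists_perm_eqOn T e e.injective.injOn
  exact ⟨g, hT g hg⟩

theorem embAct_smul (e : X ↪ X) {z : Z} (h : FinSupported X z) {g g' : Perm X}
    (hg : ∀ x, g' (e x) = e (g x)) : embAct e (g • z) = g' • embAct e z := by
  obtain ⟨T, hT⟩ := h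
  obtain ⟨k, hk⟩ := exists_perm_eqOn (T ∪ T.image g) e e.injective.injOn
  have h1 : Supports (Perm X) ((T.image g : Finset X) : Set X) (g • z) := by
    simpa using hT.smul_image g
  rw [embAct_eq h1 (g := k) (fun t ht => hk t (Finset.mem_union_right _ ht)),
    embAct_eq hT (g := k) (fun t ht => hk t (Finset.mem_union_left _ ht)), smul_smul, smul_smul]
  refine hT.smul_eq fun t ht => ?_
  rw [Perm.mul_apply, Perm.mul_apply, hk t (Finset.mem_union_left _ ht), hg,
    hk (g t) (Finset.mem_union_right _ (Finset.mem_image_of_mem _ ht))]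

/-- One permutation computes the injection on three points at once, so sums, products and scalar
multiplications are respected by injections because they are by permutations. -/
theorem exists_embAct_eq_smul₃ {Z' Z'' : Type*} [MulAction (Perm X) Z'] [MulAction (Perm X) Z'']
    (e : X ↪ X) {z : Z} {z' : Z'} {z'' : Z''} (h : FinSupported X z) (h' : FinSupported X z')
    (h'' : FinSupported X z'') : ∃ g : Perm X, embAct e z = g • z ∧ embAct e z' = g • z' ∧
      embAct e z'' = g • z'' := by
  obtain ⟨T, hT⟩ := exists_embAct_eq e h
  obtain ⟨T', hT'⟩ := exists_embAct_eq e h'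
  obtain ⟨T'', hT''⟩ := exists_embAct_eq e h''
  obtain ⟨g, hg⟩ := exists_perm_eqOn (T ∪ T' ∪ T'') e e.injective.injOn
  exact ⟨g, hT g fun t ht => hg t (by simp [ht]), hT' g fun t ht => hg t (by simp [ht]),
    hT'' g fun t ht => hg t (by simp [ht])⟩

/-- The action of injections on a field with a smooth action. -/
noncomputable def embHom {L : Type*} [Field L] [MulSemiringAction (Perm X) L] (e : X ↪ X)
    (hL : ∀ a : L, FinSupported X a) : L →+* L where
  toFun := embAct e
  map_one' := by
    obtain ⟨g, hg⟩ := exists_embAct_eq_smul e (hL 1)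
    rw [hg, smul_one]
  map_zero' := by
    obtain ⟨g, hg⟩ := exists_embAct_eq_smul e (hL 0)
    rw [hg, smul_zero]
  map_mul' a b := by
    obtain ⟨g, h1, h2, h3⟩ := exists_embAct_eq_smul₃ e (hL a) (hL b) (hL (a * b))
    rw [h1, h2, h3, smul_mul']
  map_add' a b := by
    obtain ⟨g, h1, h2, h3⟩ := exists_embAct_eq_smul₃ e (hL a) (hL b) (hL (a + b))
    rw [h1, h2, h3, smul_add]

end EmbeddingAction

/-! ### Restriction from `Perm (Ψ ⊕ M)` to `Perm Ψ`. -/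

section SumAction

open MulAction Equiv
open scoped Classical

variable {Ψ : Type u} {M : Type v} {L : Type w} [Field L] [MulSemiringAction (Perm Ψ) L]
  [MulSemiringAction (Perm (Ψ ⊕ M)) L]

/-- The action of `Perm Ψ` is the restriction of the action of `Perm (Ψ ⊕ M)`. -/
def IsRestrictedAction (Ψ : Type u) (M : Type v) (L : Type w) [Field L] [MulSemiringAction (Perm Ψ) L]
    [MulSemiringAction (Perm (Ψ ⊕ M)) L] : Prop :=
  ∀ (g : Perm Ψ) (a : L), g • a = (Perm.sumCongr g 1 : Perm (Ψ ⊕ M)) • a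

theorem IsRestrictedAction.supports (hG : IsRestrictedAction Ψ M L) {S : Set (Ψ ⊕ M)} {a : L}
    (h : Supports (Perm (Ψ ⊕ M)) S a) : Supports (Perm Ψ) (Sum.inl ⁻¹' S) a := by
  intro g hg
  rw [hG]
  refine h _ fun x hx => ?_
  rcases x with x | x
  · exact congrArg Sum.inl (hg hx)
  · rfl

theorem IsRestrictedAction.finSupported (hG : IsRestrictedAction Ψ M L) {a : L}
    (h : FinSupported (Ψ ⊕ M) a) : FinSupported Ψ a := by
  obtain ⟨T, hT⟩ := h
  refine ⟨T.preimage Sum.inl Sum.inl_injective.injOn, ?_⟩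
  rw [Finset.coe_preimage]
  exact hG.supports hT

/-- Some transposition moves some `z`. Factoring it through a point `c` off the support of `z` gives
a transposition that moves `z` and exchanges a point of the support with the outside point `c`. -/
theorem exists_swap_smul_ne {X : Type*} [Infinite X] {L : Type*} [Field L]
    [MulSemiringAction (Perm X) L] (hsm : ∀ a : L, FinSupported X a)
    (hnt : ∃ (g : Perm X) (a : L), g • a ≠ a) :
    ∃ (z : L) (a b : X) (T : Finset X), a ∉ T ∧ b ∉ T ∧ a ≠ b ∧
      Supports (Perm X) ((insert a T : Finset X) : Set X) z ∧ swap a b • z ≠ z := by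
  obtain ⟨g, z, hgz⟩ := hnt
  obtain ⟨T, hT⟩ := hsm z
  obtain ⟨a, b, hab, hz⟩ : ∃ a b : X, a ≠ b ∧ swap a b • z ≠ z := by
    by_contra hcon
    push Not at hcon
    exact hgz ((hsm z).supports_of_swap (S := ∅) (fun a b _ _ hab => hcon a b hab) g (by simp))
  obtain ⟨c, hc⟩ := Infinite.exists_notMem_finset (T ∪ {a, b})
  simp only [Finset.mem_union, Finset.mem_insert, Finset.mem_singleton, not_or] at hc
  obtain ⟨hcT, hca, hcb⟩ := hc
  have main : ∀ d, d ≠ c → swap d c • z ≠ z → ∃ (z : L) (a b : X) (T : Finset X), a ∉ T ∧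
      b ∉ T ∧ a ≠ b ∧ Supports (Perm X) ((insert a T : Finset X) : Set X) z ∧
      swap a b • z ≠ z := by
    intro d hdc hd
    have hdT : d ∈ T := by
      by_contra hdT
      exact hd (hT _ fun x hx => swap_apply_of_ne_of_ne (fun h => hdT (h ▸ hx))
        fun h => hcT (h ▸ hx))
    exact ⟨z, d, c, T.erase d, Finset.notMem_erase d T, fun h => hcT (Finset.mem_of_mem_erase h),
      hdc, by rwa [Finset.insert_erase hdT], hd⟩
  by_cases h1 : swap a c • z = z
  · by_cases h2 : swap b c • z = z
    · exfalso
      apply hz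
      have : swap a b = swap a c * swap b c * swap a c := by
        rw [swap_comm a c, swap_mul_swap_mul_swap (Ne.symm hcb) (Ne.symm hab)]
      rw [this, mul_smul, mul_smul, h1, h2, h1]
    · exact main b (Ne.symm hcb) h2
  · exact main a (Ne.symm hca) h1

/-- Translate the element `z` moved by `(a b)` by a permutation with `a ↦ t`, `b ↦ s` that sends the
rest of the support into `M`, where `Perm Ψ` does not see it. -/
theorem IsRestrictedAction.separatesPoints [Infinite M] (hG : IsRestrictedAction Ψ M L)
    (hsm : ∀ a : L, FinSupported (Ψ ⊕ M) a)
    (hnt : ∃ (g : Perm (Ψ ⊕ M)) (a : L), g • a ≠ a) : SeparatesPoints Ψ L := by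
  intro s t hst
  obtain ⟨z, a, b, T, haT, hbT, hab, hz, hne⟩ := exists_swap_smul_ne hsm hnt
  let ι : T ↪ M := T.equivFin.toEmbedding.trans (Fin.valEmbedding.trans (Infinite.natEmbedding M))
  let f : Ψ ⊕ M → Ψ ⊕ M := fun x => if h : x ∈ T then Sum.inr (ι ⟨x, h⟩) else
    if x = a then Sum.inl t else Sum.inl s
  have hfT : ∀ x (h : x ∈ T), f x = Sum.inr (ι ⟨x, h⟩) := fun x h => dif_pos h
  have hfa : f a = Sum.inl t := (dif_neg haT).trans (if_pos rfl)
  have hfb : f b = Sum.inl s := (dif_neg hbT).trans (if_neg hab.symm)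
  obtain ⟨p, hp⟩ := exists_perm_eqOn (insert a (insert b T)) f (by
    intro x hx y hy hxy
    simp only [Finset.coe_insert, Set.mem_insert_iff, Finset.mem_coe] at hx hy
    rcases hx with rfl | rfl | hx <;> rcases hy with rfl | rfl | hy
    · rfl
    · rw [hfa, hfb] at hxy
      exact (hst (Sum.inl_injective hxy).symm).elim
    · rw [hfa, hfT y hy] at hxy
      cases hxy
    · rw [hfa, hfb] at hxy
      exact (hst (Sum.inl_injective hxy)).elim
    · rfl
    · rw [hfb, hfT y hy] at hxy
      cases hxy
    · rw [hfa, hfT x hx] at hxy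
      cases hxy
    · rw [hfb, hfT x hx] at hxy
      cases hxy
    · rw [hfT x hx, hfT y hy] at hxy
      exact congrArg Subtype.val (ι.injective (Sum.inr_injective hxy)))
  have hpa : p a = Sum.inl t := by rw [hp a (by simp), hfa]
  have hpb : p b = Sum.inl s := by rw [hp b (by simp), hfb]
  refine ⟨p • z, ?_, ?_⟩
  · refine (hG.supports (hz.smul_image p)).mono ?_
    rintro x ⟨y, hy, hyx⟩
    simp only [Finset.coe_insert, Set.mem_insert_iff, Finset.mem_coe] at hy
    rcases hy with rfl | hy
    · rw [hpa] at hyx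
      exact (Sum.inl_injective hyx).symm
    · rw [hp y (by simp [hy]), hfT y hy] at hyx
      cases hyx
  · rw [hG, Perm.sumCongr_swap_one, ← hpa, ← hpb, smul_smul, ← mul_swap_eq_swap_mul, mul_smul]
    exact fun h => hne (by convert smul_left_cancel p h)

end SumAction

/-! ### Equivariant functionals. -/

section Separation

open MulAction Equiv
open scoped Classical

/-- A permutation of `Ψ ⊕ M` that moves `B` into `M`, fixes `J`, and identifies the complement of
`B` with `Ψ`. -/
theorem exists_perm_sum {Ψ : Type u} {M : Type v} [Infinite M] (B : Finset Ψ) (J : Finset M)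
    (e : Ψ ≃ {x // x ∉ B}) (σ : {x // x ∈ B} ⊕ {m // m ∉ J} ≃ {m // m ∉ J}) :
    ∃ h : Perm (Ψ ⊕ M), (∀ x, h (Sum.inl (e x)) = Sum.inl x) ∧
      (∀ b ∈ B, ∃ m, h (Sum.inl b) = Sum.inr m) ∧ (∀ m ∈ J, h (Sum.inr m) = Sum.inr m) ∧
      ∀ m, ∃ m', h (Sum.inr m) = Sum.inr m' := by
  let α : {x // x ∈ B} ⊕ {x // x ∉ B} ≃ Ψ := Equiv.sumCompl (· ∈ B)
  let β : {m // m ∈ J} ⊕ {m // m ∉ J} ≃ M := Equiv.sumCompl (· ∈ J)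
  -- Regrouping moves `B` to the side of `M`, where `σ` absorbs it into the complement of `J`.
  let γ : ({x // x ∈ B} ⊕ {x // x ∉ B}) ⊕ ({m // m ∈ J} ⊕ {m // m ∉ J}) ≃
      {x // x ∉ B} ⊕ ({m // m ∈ J} ⊕ ({x // x ∈ B} ⊕ {m // m ∉ J})) :=
    { toFun := Sum.elim (Sum.elim (fun b => Sum.inr (Sum.inr (Sum.inl b))) Sum.inl)
        (Sum.elim (fun j => Sum.inr (Sum.inl j)) fun m => Sum.inr (Sum.inr (Sum.inr m)))
      invFun := Sum.elim (fun x => Sum.inl (Sum.inr x)) (Sum.elim (fun j => Sum.inr (Sum.inl j))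
        (Sum.elim (fun b => Sum.inl (Sum.inl b)) fun m => Sum.inr (Sum.inr m)))
      left_inv := by rintro ((x | x) | (x | x)) <;> rfl
      right_inv := by rintro (x | (x | (x | x))) <;> rfl }
  let h : Perm (Ψ ⊕ M) := (Equiv.sumCongr α.symm β.symm).trans (γ.trans
    (Equiv.sumCongr e.symm ((Equiv.sumCongr (Equiv.refl _) σ).trans β)))
  have hα : ∀ x : {x // x ∉ B}, α.symm x = Sum.inr x := fun x => by
    rw [Equiv.symm_apply_eq]; rfl
  have hα' : ∀ x : {x // x ∈ B}, α.symm x = Sum.inl x := fun x => by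
    rw [Equiv.symm_apply_eq]; rfl
  have hβ : ∀ x : {x // x ∈ J}, β.symm x = Sum.inl x := fun x => by
    rw [Equiv.symm_apply_eq]; rfl
  refine ⟨h, fun x => ?_, fun b hb => ⟨β (Sum.inr (σ (Sum.inl ⟨b, hb⟩))), ?_⟩, fun m hm => ?_,
    fun m => ?_⟩
  · simp [h, hα, γ]
  · simp [h, hα' ⟨b, hb⟩, γ]
  · simp [h, hβ ⟨m, hm⟩, γ, β]
  · rcases hm : β.symm m with x | x
    · exact ⟨β (Sum.inl x), by simp [h, hm, γ]⟩
    · exact ⟨β (Sum.inr (σ (Sum.inr x))), by simp [h, hm, γ]⟩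

variable {Ψ : Type u} {M : Type v} {L : Type w} [Field L] [MulSemiringAction (Perm Ψ) L]
  [MulSemiringAction (Perm (Ψ ⊕ M)) L]

theorem smul_mem_orbitSpan {X : Type*} [MulSemiringAction (Perm X) L] {V : Type*} [AddCommGroup V]
    [Module L V] [DistribMulAction (Perm X) V]
    (hV : ∀ (g : Perm X) (a : L) (x : V), g • (a • x) = (g • a) • (g • x)) (Y : Set V)
    (g : Perm X) : ∀ x ∈ orbitSpan X L Y, g • x ∈ orbitSpan X L Y := by
  refine smul_mem_span hV g ?_
  rintro _ ⟨k, y, hy, rfl⟩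
  exact Submodule.subset_span ⟨g * k, y, hy, by rw [mul_smul]⟩

theorem mem_orbitSpan {X : Type*} {V : Type*} [AddCommGroup V]
    [Module L V] [DistribMulAction (Perm X) V] {Y : Set V} {y : V} (hy : y ∈ Y) :
    y ∈ orbitSpan X L Y :=
  Submodule.subset_span ⟨1, y, hy, (one_smul _ y).symm⟩

/-- Start from a functional `φ` equivariant under the stabilizer of `B`. Composing it with the
injection `e` of `Ψ` onto the complement of `B` gives a map `θ` that is equivariant along `g ↦ E g`
and semilinear along `embHom e`. A permutation `h` of `Ψ ⊕ M` that undoes `e` turns `E g` back into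
`g`. On scalars, `h` inverts `embHom e` only on elements supported off the rest of `M`, so the new
functional is prescribed on the generators, and the specialization of relations shows it is well
defined. -/
theorem exists_equivariant_of_finite [Infinite Ψ] [Infinite M] (hG : IsRestrictedAction Ψ M L)
    (hsm : ∀ a : L, FinSupported (Ψ ⊕ M) a)
    (hnt : ∃ (g : Perm (Ψ ⊕ M)) (a : L), g • a ≠ a)
    {V : Type*} [AddCommGroup V] [Module L V] [DistribMulAction (Perm Ψ) V]
    (hV : ∀ (g : Perm Ψ) (a : L) (x : V), g • (a • x) = (g • a) • (g • x))
    (hVs : ∀ x : V, FinSupported Ψ x) (Y : Finset V) {x : V} (hxY : x ∈ Y) (hx0 : x ≠ 0) :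
    ∃ ψ : V →ₗ[L] L, ψ x ≠ 0 ∧ ∀ g : Perm Ψ, ∀ w ∈ orbitSpan Ψ L (Y : Set V),
      ψ (g • w) = g • ψ w := by
  have hLs : ∀ a : L, FinSupported Ψ a := fun a => hG.finSupported (hsm a)
  obtain ⟨B, hB⟩ := exists_separatedOver_orbitSpan (hG.separatesPoints hsm hnt) hV Y
    fun y _ => hVs y
  have hcardB : Nonempty (Ψ ≃ {x // x ∉ B}) := by
    rw [← Cardinal.eq]
    exact (Cardinal.mk_compl_finset_of_infinite B).symm
  obtain ⟨e₀⟩ := hcardB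
  let e : Ψ ↪ Ψ := e₀.toEmbedding.trans (Function.Embedding.subtype _)
  have hW := smul_mem_orbitSpan hV (Y : Set V)
  have heW : ∀ w ∈ orbitSpan Ψ L (Y : Set V), embAct e w ∈ orbitSpan Ψ L (Y : Set V) := by
    intro w hw
    obtain ⟨g, hg⟩ := exists_embAct_eq_smul e (hVs w)
    rw [hg]
    exact hW g w hw
  have hex0 : embAct e x ≠ 0 := by
    obtain ⟨g, hg⟩ := exists_embAct_eq_smul e (hVs x)
    rwa [hg, smul_ne_zero_iff_ne]
  obtain ⟨φ, hφ, hφg⟩ := hB _ (heW x (mem_orbitSpan hxY)) hex0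
  choose D hD using fun y : V => hsm (φ (embAct e y))
  -- `J` is the part in `M` of the supports of the finitely many values `θ y`; `h` must leave it
  -- alone.
  let J : Finset M := Y.biUnion fun y => (D y).preimage Sum.inr Sum.inr_injective.injOn
  have hJ : ∀ y ∈ Y, ∀ m, Sum.inr m ∈ D y → m ∈ J := fun y hy m hm =>
    Finset.mem_biUnion.2 ⟨y, hy, Finset.mem_preimage.2 hm⟩
  have hJinf : Infinite {m // m ∉ J} := (Finset.finite_toSet J).infinite_compl.to_subtype
  have hcardJ : Nonempty ({x // x ∈ B} ⊕ {m // m ∉ J} ≃ {m // m ∉ J}) := by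
    rw [← Cardinal.lift_mk_eq']
    simp only [Cardinal.mk_sum, Cardinal.lift_add, Cardinal.lift_lift]
    rw [Cardinal.add_eq_right]
    · simp
    · refine le_trans ?_ (b := Cardinal.aleph0) ?_
      · simp
      · simp
  obtain ⟨σ⟩ := hcardJ
  obtain ⟨h, hhe, hhB, hhJ, hhM⟩ := exists_perm_sum B J e₀ σ
  have hext : ∀ g : Perm Ψ, ∃ g' : Perm Ψ, (∀ x, g' (e x) = e (g x)) ∧ ∀ b ∈ B, g' b = b :=
    fun g => ⟨g.extendDomain e₀, fun x => g.extendDomain_apply_image e₀ x,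
      fun b hb => g.extendDomain_apply_not_subtype e₀ (not_not.2 hb)⟩
  choose E hEe hEB using hext
  have hconj : ∀ (g : Perm Ψ) (a : L), h • (E g • a) = g • (h • a) := by
    intro g a
    rw [hG, hG, smul_smul, smul_smul]
    congr 1
    ext z : 1
    rw [Perm.mul_apply, Perm.mul_apply]
    rcases z with z | z
    · by_cases hz : z ∈ B
      · obtain ⟨m, hm⟩ := hhB z hz
        have : (Perm.sumCongr (E g) 1 : Perm (Ψ ⊕ M)) (Sum.inl z) = Sum.inl z :=
          congrArg Sum.inl (hEB g z hz)
        rw [this, hm]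
        rfl
      · obtain ⟨y, hy⟩ := e₀.surjective ⟨z, hz⟩
        have hy' : z = e y := (congrArg Subtype.val hy).symm
        have h1 : (Perm.sumCongr (E g) 1 : Perm (Ψ ⊕ M)) (Sum.inl (e y)) = Sum.inl (e (g y)) :=
          congrArg Sum.inl (hEe g y)
        have h2 : ∀ y, h (Sum.inl (e y)) = Sum.inl y := hhe
        rw [hy', h1, h2, h2]
        rfl
    · obtain ⟨m, hm⟩ := hhM z
      have : (Perm.sumCongr (E g) 1 : Perm (Ψ ⊕ M)) (Sum.inr z) = Sum.inr z := rfl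
      rw [this, hm]
      rfl
  let θ : V → L := fun w => φ (embAct e w)
  have hθg : ∀ g : Perm Ψ, ∀ w ∈ orbitSpan Ψ L (Y : Set V), θ (g • w) = E g • θ w := by
    intro g w hw
    simp only [θ]
    rw [embAct_smul e (hVs w) (hEe g), hφg _ (hEB g) _ (heW w hw)]
  have hθadd : ∀ w w', θ (w + w') = θ w + θ w' := by
    intro w w'
    obtain ⟨g, h1, h2, h3⟩ := exists_embAct_eq_smul₃ e (hVs w) (hVs w') (hVs (w + w'))
    simp only [θ]
    rw [h1, h2, h3, smul_add, map_add]
  have hθsmul : ∀ (a : L) w, θ (a • w) = embHom e hLs a * θ w := by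
    intro a w
    obtain ⟨g, h1, h2, h3⟩ := exists_embAct_eq_smul₃ e (hLs a) (hVs w) (hVs (a • w))
    have h1' : embHom e hLs a = g • a := h1
    simp only [θ]
    rw [h1', h2, h3, hV, map_smul, smul_eq_mul]
  -- `S` is `Ψ ∪ J`, and `H` consists of the permutations of `M` off `J`. They fix the elements `E k
  -- • θ y` and commute with `embHom e`, as the specialization lemma requires.
  let S : Set (Ψ ⊕ M) := {z | ∀ m, z = Sum.inr m → m ∈ J}
  have hSl : ∀ x, Sum.inl x ∈ S := fun x m hm => by cases hm
  let H : Set (L →+* L) := {p | ∃ k : Perm (Ψ ⊕ M), (∀ z ∈ S, k z = z) ∧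
    p = MulSemiringAction.toRingHom _ L k}
  have hkr : ∀ k : Perm (Ψ ⊕ M), (∀ z ∈ S, k z = z) → ∀ m, ∃ m', k (Sum.inr m) = Sum.inr m' := by
    intro k hk m
    rcases hm : k (Sum.inr m) with x | x
    · have := hk (Sum.inl x) (hSl x)
      rw [← this] at hm
      cases k.injective hm
    · exact ⟨x, rfl⟩
  have hcomm : ∀ k : Perm (Ψ ⊕ M), (∀ z ∈ S, k z = z) → ∀ a : L,
      k • embHom e hLs a = embHom e hLs (k • a) := by
    intro k hk a
    obtain ⟨g, h1, h2, -⟩ := exists_embAct_eq_smul₃ e (hLs a) (hLs (k • a)) (hLs a)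
    have h1' : embHom e hLs a = g • a := h1
    have h2' : embHom e hLs (k • a) = g • (k • a) := h2
    rw [h1', h2', hG, hG, smul_smul, smul_smul]
    congr 1
    ext z : 1
    rw [Perm.mul_apply, Perm.mul_apply]
    rcases z with z | z
    · rw [hk (Sum.inl z) (hSl z)]
      exact hk _ (hSl _)
    · obtain ⟨m, hm⟩ := hkr k hk z
      have : (Perm.sumCongr g 1 : Perm (Ψ ⊕ M)) (Sum.inr z) = Sum.inr z := rfl
      rw [this, hm]
      rfl
  have hSinf : Sᶜ.Infinite := by
    refine (Set.infinite_range_of_injective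
      (f := fun m : {m // m ∉ J} => (Sum.inr m.1 : Ψ ⊕ M)) ?_).mono ?_
    · exact fun m m' hm => Subtype.ext (Sum.inr_injective hm)
    · rintro _ ⟨m, rfl⟩ hm
      exact m.2 (hm m.1 rfl)
  let κ := Perm Ψ × Y
  obtain ⟨ψ, hψ⟩ := exists_linearMap_apply_eq (L := L) (fun k : κ => k.1 • (k.2 : V))
    (fun k => k.1 • (h • θ k.2)) (by
      intro f hf
      have hrel : ∑ k ∈ f.support, embHom e hLs (f k) * (E k.1 • θ (k.2 : V)) = 0 := by
        have h0 : θ 0 = 0 := by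
          have := hθadd 0 0
          rwa [add_zero, left_eq_add] at this
        let θ' : V →+ L := ⟨⟨θ, h0⟩, hθadd⟩
        have h1 : θ' (Finsupp.linearCombination L (fun k : κ => k.1 • (k.2 : V)) f) = 0 := by
          rw [hf, map_zero]
        rw [Finsupp.linearCombination_apply, Finsupp.sum, map_sum] at h1
        rw [← h1]
        refine Finset.sum_congr rfl fun k _ => ?_
        change _ = θ (f k • (k.1 • (k.2 : V)))
        rw [hθsmul, hθg _ _ (mem_orbitSpan k.2.2)]
      have := sum_mul_eq_zero_of_fixed (embHom e hLs) (MulSemiringAction.toRingHom _ L h) H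
        (by
          rintro _ ⟨k, hk, rfl⟩ a
          exact ⟨k • a, hcomm k hk a⟩)
        (by
          intro a ha
          have hSa : Supports (Perm (Ψ ⊕ M)) S a := by
            intro k hk
            apply (embHom e hLs).injective
            rw [← hcomm k (fun z hz => hk hz)]
            exact ha _ ⟨k, fun z hz => hk hz, rfl⟩
          -- A scalar fixed by `H` has a finite support inside `Ψ ∪ J`, where `h ∘ e` on `Ψ` and `h`
          -- on `J` are the identity; so `h` inverts `embHom e` at this scalar.
          obtain ⟨T, hTS, hT⟩ := (hsm a).exists_subset hSa hSinf
          obtain ⟨g, hg⟩ := exists_perm_eqOn (T.preimage Sum.inl Sum.inl_injective.injOn) e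
            e.injective.injOn
          have h1 : embHom e hLs a = g • a := embAct_eq (by
            rw [Finset.coe_preimage]
            exact hG.supports hT) hg
          rw [h1, hG]
          change h • ((Perm.sumCongr g 1 : Perm (Ψ ⊕ M)) • a) = a
          rw [smul_smul]
          refine hT _ fun z hz => ?_
          rw [Perm.smul_def, Perm.mul_apply]
          rcases z with z | z
          · have : (Perm.sumCongr g 1 : Perm (Ψ ⊕ M)) (Sum.inl z) = Sum.inl (e z) :=
              congrArg Sum.inl (hg z (Finset.mem_preimage.2 hz))
            rw [this]
            exact hhe z
          · exact hhJ z (hTS hz z rfl))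
        (fun k : κ => E k.1 • θ (k.2 : V)) f.support f (by
          rintro k - _ ⟨q, hq, rfl⟩
          change q • (E k.1 • θ (k.2 : V)) = _
          rw [hG]
          refine (hD k.2).smul_image (Perm.sumCongr (E k.1) 1) q ?_
          rintro _ ⟨z, hz, rfl⟩
          refine hq _ ?_
          rcases z with z | z
          · exact hSl _
          · intro m hm
            exact hJ k.2 k.2.2 m (by rwa [← show (Sum.inr z : Ψ ⊕ M) = Sum.inr m from hm]))
        hrel
      rw [Finsupp.linearCombination_apply, Finsupp.sum, ← this]
      refine Finset.sum_congr rfl fun k _ => ?_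
      rw [smul_eq_mul, ← hconj]
      rfl)
  refine ⟨ψ, ?_, fun g => ?_⟩
  · have := hψ (1, ⟨x, hxY⟩)
    simp only [one_smul] at this
    rw [this, smul_ne_zero_iff_ne]
    exact hφ
  · refine map_smul_of_mem_span hV ψ g _ ?_
    rintro _ ⟨k, y, hy, rfl⟩
    have h1 := hψ (k, ⟨y, hy⟩)
    have h2 := hψ (g * k, ⟨y, hy⟩)
    simp only [mul_smul] at h1 h2
    rw [h1, h2]

/-- The action on the quotient of a semilinear representation by a subrepresentation. -/
@[reducible]
noncomputable def quotientAction {X : Type*} {L : Type*} [Field L] {V : Type*} [AddCommGroup V]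
    [Module L V] [DistribMulAction (Perm X) V] (N : Submodule L V)
    (hN : ∀ g : Perm X, ∀ x ∈ N, g • x ∈ N) : DistribMulAction (Perm X) (V ⧸ N) :=
  let f : Perm X → (V ⧸ N) →+ (V ⧸ N) := fun g =>
    QuotientAddGroup.map N.toAddSubgroup N.toAddSubgroup (DistribSMul.toAddMonoidHom V g)
      fun x hx => hN g x hx
  { smul := fun g x => f g x
    one_smul := fun x => by
      obtain ⟨x, rfl⟩ := N.mkQ_surjective x
      exact congrArg N.mkQ (one_smul _ x)
    mul_smul := fun g h x => by
      obtain ⟨x, rfl⟩ := N.mkQ_surjective x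
      exact congrArg N.mkQ (mul_smul g h x)
    smul_zero := fun g => map_zero (f g)
    smul_add := fun g x y => map_add (f g) x y }

/-- The smooth semilinear representations over a field with a nontrivial smooth action of
`Perm (Ψ ⊕ M)` have enough equivariant functionals. -/
theorem exists_equivariant_ne_zero [Infinite Ψ] [Infinite M] (hG : IsRestrictedAction Ψ M L)
    (hsm : ∀ a : L, FinSupported (Ψ ⊕ M) a)
    (hnt : ∃ (g : Perm (Ψ ⊕ M)) (a : L), g • a ≠ a)
    {V : Type*} [AddCommGroup V] [Module L V] [DistribMulAction (Perm Ψ) V]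
    (hV : ∀ (g : Perm Ψ) (a : L) (x : V), g • (a • x) = (g • a) • (g • x))
    (hVs : ∀ x : V, FinSupported Ψ x) {v : V} (hv : v ≠ 0) :
    ∃ ψ : V →ₗ[L] L, ψ v ≠ 0 ∧ ∀ (g : Perm Ψ) (w : V), ψ (g • w) = g • ψ w := by
  -- Take a subrepresentation `N` maximal among those avoiding `v`; in `V ⧸ N` every nonzero
  -- subrepresentation contains the image of `v`.
  obtain ⟨N, -, hN⟩ := zorn_le_nonempty₀
    {N : Submodule L V | (∀ g : Perm Ψ, ∀ x ∈ N, g • x ∈ N) ∧ v ∉ N} (by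
      intro c hc hchain N₀ hN₀
      refine ⟨sSup c, ⟨?_, ?_⟩, fun N hN => le_sSup hN⟩
      · intro g x hx
        rw [Submodule.mem_sSup_of_directed ⟨N₀, hN₀⟩ hchain.directedOn] at hx ⊢
        obtain ⟨N, hN, hx⟩ := hx
        exact ⟨N, hN, (hc hN).1 g x hx⟩
      · intro hx
        rw [Submodule.mem_sSup_of_directed ⟨N₀, hN₀⟩ hchain.directedOn] at hx
        obtain ⟨N, hN, hx⟩ := hx
        exact (hc hN).2 hx) ⊥ ⟨fun g x hx => by
          rw [(Submodule.mem_bot L).1 hx, smul_zero]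
          exact Submodule.zero_mem _, fun h => hv ((Submodule.mem_bot L).1 h)⟩
  obtain ⟨⟨hNg, hvN⟩, hmax⟩ := hN
  let _ : DistribMulAction (Perm Ψ) (V ⧸ N) := quotientAction N hNg
  have hmk : ∀ (g : Perm Ψ) (x : V), N.mkQ (g • x) = g • N.mkQ x := fun _ _ => rfl
  have hQ : ∀ (g : Perm Ψ) (a : L) (x : V ⧸ N), g • (a • x) = (g • a) • (g • x) := by
    intro g a x
    obtain ⟨x, rfl⟩ := N.mkQ_surjective x
    rw [← map_smul, ← hmk, hV, map_smul, hmk]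
  have hQs : ∀ x : V ⧸ N, FinSupported Ψ x := by
    intro x
    obtain ⟨x, rfl⟩ := N.mkQ_surjective x
    obtain ⟨T, hT⟩ := hVs x
    exact ⟨T, fun g hg => by rw [← hmk, hT g hg]⟩
  have hv0 : N.mkQ v ≠ 0 := by rwa [Ne, Submodule.mkQ_apply, Submodule.Quotient.mk_eq_zero]
  -- An equivariant functional on the span of the orbits of `v` and `w` that is nonzero at `v` has a
  -- kernel avoiding `v`, hence zero kernel by maximality. So the quotient is a line.
  have hline : ∀ w : V ⧸ N, ∃ a : L, w = a • N.mkQ v := by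
    intro w
    obtain ⟨ψ, hψv, hψg⟩ := exists_equivariant_of_finite hG hsm hnt hQ hQs {N.mkQ v, w}
      (Finset.mem_insert_self _ _) hv0
    set W := orbitSpan Ψ L (({N.mkQ v, w} : Finset (V ⧸ N)) : Set (V ⧸ N))
    have hWv : N.mkQ v ∈ W := mem_orbitSpan (by simp)
    have hWw : w ∈ W := mem_orbitSpan (by simp)
    have hle : (W ⊓ LinearMap.ker ψ).comap N.mkQ ≤ N := by
      refine hmax ⟨fun g x hx => ?_, fun h => hψv h.2⟩ fun x hx => ?_
      · have h1 : N.mkQ x ∈ W := hx.1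
        have h2 : ψ (N.mkQ x) = 0 := hx.2
        refine ⟨?_, ?_⟩
        · change N.mkQ (g • x) ∈ W
          rw [hmk]
          exact smul_mem_orbitSpan hQ _ g _ h1
        · change ψ (N.mkQ (g • x)) = 0
          rw [hmk, hψg g _ h1, h2, smul_zero]
      · have : N.mkQ x = 0 := by rwa [Submodule.mkQ_apply, Submodule.Quotient.mk_eq_zero]
        rw [Submodule.mem_comap, this]
        exact Submodule.zero_mem _
    refine ⟨ψ w / ψ (N.mkQ v), ?_⟩
    rw [← sub_eq_zero]
    have hu : w - (ψ w / ψ (N.mkQ v)) • N.mkQ v ∈ W ⊓ LinearMap.ker ψ :=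
      ⟨Submodule.sub_mem _ hWw (Submodule.smul_mem _ _ hWv), by
        change ψ _ = 0
        rw [map_sub, map_smul, smul_eq_mul, div_mul_cancel₀ _ hψv, sub_self]⟩
    obtain ⟨z, hz⟩ := N.mkQ_surjective (w - (ψ w / ψ (N.mkQ v)) • N.mkQ v)
    rw [← hz] at hu ⊢
    rw [Submodule.mkQ_apply, Submodule.Quotient.mk_eq_zero]
    exact hle hu
  obtain ⟨ψ, hψv, hψg⟩ := exists_equivariant_of_finite hG hsm hnt hQ hQs {N.mkQ v}
    (Finset.mem_singleton_self _) hv0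
  refine ⟨ψ.comp N.mkQ, hψv, fun g w => ?_⟩
  rw [LinearMap.comp_apply, LinearMap.comp_apply, hmk]
  obtain ⟨a, ha⟩ := hline (N.mkQ w)
  refine hψg g _ ?_
  rw [ha]
  exact Submodule.smul_mem _ _ (mem_orbitSpan (by simp))

end Separation

/-! ### Weak period extensions of smooth fields. -/

section WeakPeriodExtension

open MulAction Equiv
open scoped Classical

/-- A smooth field over which the action extends nontrivially to `Perm (Ψ ⊕ M)` is a cogenerator
of the category of its smooth semilinear representations. -/
theorem isCoseparator_unit {Ψ : Type v} {M : Type w} {L : Type u} [Field L]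
    [MulSemiringAction (Perm Ψ) L] [MulSemiringAction (Perm (Ψ ⊕ M)) L] [Infinite Ψ] [Infinite M]
    (hG : IsRestrictedAction Ψ M L) (hsm : ∀ a : L, FinSupported (Ψ ⊕ M) a)
    (hnt : ∃ (g : Perm (Ψ ⊕ M)) (a : L), g • a ≠ a) (h : IsSmoothAction (Perm Ψ) Ψ L) :
    IsCoseparator (SmRep.unit h) := by
  rw [isCoseparator_def]
  intro V W f f' hff
  refine SmRep.Hom.ext (LinearMap.ext fun x => ?_)
  by_contra hne
  obtain ⟨ψ, hψ, hψg⟩ := exists_equivariant_ne_zero hG hsm hnt W.semilinear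
    (isSmoothAction_iff.1 W.smooth) (sub_ne_zero.2 hne)
  have h1 := congrArg SmRep.Hom.toLinearMap (hff ⟨ψ, hψg⟩)
  have h2 : ψ (f.toLinearMap x) = ψ (f'.toLinearMap x) := LinearMap.congr_fun h1 x
  rw [map_sub, h2, sub_self] at hψ
  exact hψ rfl

/-- Adjoining permuted variables makes the action on a smooth field nontrivial. -/
theorem exists_nontrivial_extension (Ψ : Type v) [Infinite Ψ] (K : Type u) [Field K]
    [MulSemiringAction (Perm Ψ) K] (hsm : ∀ a : K, FinSupported Ψ a) :
    ∃ (F : Type (max u v)) (_ : Field F) (_ : MulSemiringAction (Perm Ψ) F) (i : K →+* F),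
      (∀ (g : Perm Ψ) (a : K), i (g • a) = g • i a) ∧ (∀ a : F, FinSupported Ψ a) ∧
      ∃ (g : Perm Ψ) (a : F), g • a ≠ a := by
  let R := MvPolynomial Ψ K
  let φ : Perm Ψ → R →+* R := fun g => MvPolynomial.eval₂Hom
    (MvPolynomial.C.comp (MulSemiringAction.toRingHom _ K g)) fun i => MvPolynomial.X (g i)
  have hφC : ∀ g a, φ g (MvPolynomial.C a) = MvPolynomial.C (g • a) := fun g a =>
    MvPolynomial.eval₂Hom_C _ _ _
  have hφX : ∀ g i, φ g (MvPolynomial.X i) = MvPolynomial.X (g i) := fun g i =>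
    MvPolynomial.eval₂Hom_X' _ _ _
  have hmul : ∀ g h, (φ g).comp (φ h) = φ (g * h) := fun g h =>
    MvPolynomial.ringHom_ext (fun a => by
      rw [RingHom.comp_apply, hφC, hφC, hφC, mul_smul]) fun i => by
      rw [RingHom.comp_apply, hφX, hφX, hφX, Perm.mul_apply]
  have hone : φ 1 = RingHom.id R := MvPolynomial.ringHom_ext (fun a => by
      rw [hφC, one_smul, RingHom.id_apply]) fun i => by rw [hφX, Perm.one_apply, RingHom.id_apply]
  let ρ : Perm Ψ →* (R ≃+* R) :=
    { toFun := fun g => RingEquiv.ofRingHom (φ g) (φ g⁻¹) (by rw [hmul, mul_inv_cancel, hone])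
        (by rw [hmul, inv_mul_cancel, hone])
      map_one' := RingEquiv.ext fun x => RingHom.congr_fun hone x
      map_mul' := fun g h => RingEquiv.ext fun x => (RingHom.congr_fun (hmul g h) x).symm }
  let F := FractionRing R
  let act : MulSemiringAction (Perm Ψ) F :=
    MulSemiringAction.compHom F ((IsFractionRing.ringEquivOfRingEquivHom R F).comp ρ)
  have hact : ∀ (g : Perm Ψ) (r : R), g • algebraMap R F r = algebraMap R F (φ g r) := fun g r =>
    IsFractionRing.ringEquivOfRingEquiv_algebraMap (ρ g) r
  have hR : ∀ r : R, ∃ T : Finset Ψ, ∀ g : Perm Ψ, (∀ t ∈ T, g t = t) → φ g r = r := by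
    intro r
    induction r using MvPolynomial.induction_on with
    | C a =>
      obtain ⟨T, hT⟩ := hsm a
      exact ⟨T, fun g hg => by rw [hφC, hT g fun t ht => hg t ht]⟩
    | add p q hp hq =>
      obtain ⟨T, hT⟩ := hp
      obtain ⟨T', hT'⟩ := hq
      exact ⟨T ∪ T', fun g hg => by
        rw [map_add, hT g fun t ht => hg t (Finset.mem_union_left _ ht),
          hT' g fun t ht => hg t (Finset.mem_union_right _ ht)]⟩
    | mul_X p i hp =>
      obtain ⟨T, hT⟩ := hp
      exact ⟨insert i T, fun g hg => by
        rw [map_mul, hT g fun t ht => hg t (Finset.mem_insert_of_mem ht), hφX,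
          hg i (Finset.mem_insert_self _ _)]⟩
  refine ⟨F, inferInstance, act, (algebraMap R F).comp MvPolynomial.C, fun g a => ?_,
    fun a => ?_, ?_⟩
  · rw [RingHom.comp_apply, RingHom.comp_apply, hact, hφC]
  · obtain ⟨p, q, -, rfl⟩ := IsFractionRing.div_surjective (A := R) a
    obtain ⟨T, hT⟩ := hR p
    obtain ⟨T', hT'⟩ := hR q
    refine ⟨T ∪ T', fun g hg => ?_⟩
    rw [smul_div₀', hact, hact, hT g fun t ht => hg (by simp [ht]),
      hT' g fun t ht => hg (by simp [ht])]
  · obtain ⟨a, b, hab⟩ := exists_pair_ne Ψ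
    refine ⟨swap a b, algebraMap R F (MvPolynomial.X a), fun h => hab ?_⟩
    rw [hact, hφX, swap_apply_left] at h
    exact (MvPolynomial.X_injective (IsFractionRing.injective R F h)).symm

/-- The field is `F` itself, with `Perm Ψ` acting through the first half of `Ψ ⊕ Ψ ≃ Ψ`. The
inclusion of `K` is twisted by the injection `e` onto that half, which makes it equivariant for the
new action. -/
theorem exists_isWeakPeriodExtension (Ψ : Type v) [Infinite Ψ] (K : Type u) [Field K]
    [MulSemiringAction (Perm Ψ) K] (hsm : IsSmoothAction (Perm Ψ) Ψ K) :
    ∃ (L : Type (max u v)) (_ : Field L) (_ : MulSemiringAction (Perm Ψ) L) (_ : Algebra K L),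
      IsWeakPeriodExtension (Perm Ψ) Ψ K L := by
  obtain ⟨F, _, act, i, hi, hF, hnt⟩ := exists_nontrivial_extension Ψ K (isSmoothAction_iff.1 hsm)
  have hβ : Nonempty (Ψ ⊕ Ψ ≃ Ψ) := by
    rw [← Cardinal.eq, Cardinal.mk_sum, Cardinal.lift_id, Cardinal.add_eq_self]
    exact Cardinal.aleph0_le_mk Ψ
  obtain ⟨β⟩ := hβ
  let e : Ψ ↪ Ψ := Function.Embedding.inl.trans β.toEmbedding
  let j : K →+* F := (embHom e hF).comp i
  have hj : ∀ g g' : Perm Ψ, (∀ x, g' (e x) = e (g x)) → ∀ a : K, j (g • a) = g' • j a :=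
    fun g g' hg a => by
      change embAct e (i (g • a)) = g' • embAct e (i a)
      rw [hi]
      exact embAct_smul e (hF _) hg
  let ρ : Perm (Ψ ⊕ Ψ) →* Perm Ψ := β.permCongrHom.toMonoidHom
  let σ : Perm Ψ →* Perm Ψ :=
    ρ.comp ((Perm.sumCongrHom Ψ Ψ).comp (MonoidHom.inl (Perm Ψ) (Perm Ψ)))
  have hρ : ∀ g x, ρ g (β x) = β (g x) := fun g x => by simp [ρ]
  have hσ : ∀ g x, σ g (e x) = e (g x) := fun g x => hρ _ _
  let act₂ : MulSemiringAction (Perm (Ψ ⊕ Ψ)) F := MulSemiringAction.compHom F ρ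
  let act₁ : MulSemiringAction (Perm Ψ) F := MulSemiringAction.compHom F σ
  have hG : @IsRestrictedAction Ψ Ψ F _ act₁ act₂ := fun _ _ => rfl
  have hF₂ : ∀ a : F, FinSupported (Ψ ⊕ Ψ) a := by
    intro a
    obtain ⟨T, hT⟩ := hF a
    refine ⟨T.map β.symm.toEmbedding, fun g hg => ?_⟩
    refine hT (ρ g) fun x hx => ?_
    obtain ⟨y, rfl⟩ := β.surjective x
    have : g y = y := hg (Finset.mem_coe.2 (Finset.mem_map.2 ⟨β y, hx, by simp⟩))
    rw [Perm.smul_def, hρ, this]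
  have hnt₂ : ∃ (g : Perm (Ψ ⊕ Ψ)) (a : F), g • a ≠ a := by
    obtain ⟨g, a, hga⟩ := hnt
    obtain ⟨g, rfl⟩ := β.permCongrHom.surjective g
    exact ⟨g, a, hga⟩
  have hsm₁ : @IsSmoothAction (Perm Ψ) Ψ F _ _ act₁.toMulAction :=
    isSmoothAction_iff.2 fun a => hG.finSupported (hF₂ a)
  let alg : Algebra K F := j.toAlgebra
  refine ⟨F, inferInstance, act₁, alg, ⟨fun g a => ?_, hsm₁, ?_⟩⟩
  · exact hj g (σ g) (hσ g) a
  · exact isCoseparator_unit hG hF₂ hnt₂ hsm₁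

end WeakPeriodExtension

/-! ### Germs: from functors on `FI` to smooth representations. -/

section Germs

open scoped Classical

/-- The corestriction of an embedding to a finite subset. -/
def FI.toSubset {Ω : Type} {I : FI} (e : I.carrier ↪ Ω) (T : Finset Ω) (h : ∀ x, e x ∈ T) :
    I ⟶ (finiteSubsets Ω).obj T :=
  FI.homOfEmbedding (J := (finiteSubsets Ω).obj T)
    ⟨fun x => ⟨e x, h x⟩, fun _ _ hxy => e.injective (congrArg Subtype.val hxy)⟩

/-- The inclusion of a finite subset. -/
def FI.subsetEmb {Ω : Type} (T : Finset Ω) : ((finiteSubsets Ω).obj T).carrier ↪ Ω :=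
  Function.Embedding.subtype fun x => x ∈ T

/-- The image of an embedding of a finite set. -/
noncomputable def FI.image {Ω : Type} {I : FI} (e : I.carrier ↪ Ω) : Finset Ω :=
  (Set.finite_range e).toFinset

theorem FI.mem_image {Ω : Type} {I : FI} (e : I.carrier ↪ Ω) {x : Ω} :
    x ∈ FI.image e ↔ ∃ y, e y = x := by
  simp [FI.image]

theorem FI.apply_mem_image {Ω : Type} {I : FI} (e : I.carrier ↪ Ω) (x : I.carrier) :
    e x ∈ FI.image e := (FI.mem_image e).2 ⟨x, rfl⟩

variable {C : Type*} [Category C] {FC : C → C → Type*} {CC : C → Type*}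
  [∀ X Y, FunLike (FC X Y) (CC X) (CC Y)] [ConcreteCategory C FC] (A : FI ⥤ C) (Ω : Type)

instance germDirectedSystem : DirectedSystem
    (fun T : Finset Ω => CC (A.obj ((finiteSubsets Ω).obj T)))
    fun _ _ h => ConcreteCategory.hom (A.map ((finiteSubsets Ω).map (homOfLE h))) where
  map_self i x := by
    rw [show homOfLE (le_refl i) = 𝟙 i from rfl, (finiteSubsets Ω).map_id, A.map_id]
    exact ConcreteCategory.id_apply x
  map_map i j k hij hjk x := by
    rw [← ConcreteCategory.comp_apply, ← Functor.map_comp, ← Functor.map_comp]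
    rfl

/-- The colimit of the values of `A` at the finite subsets of `Ω`. -/
def Germ : Type _ :=
  DirectLimit (fun T : Finset Ω => CC (A.obj ((finiteSubsets Ω).obj T)))
    fun _ _ h => ConcreteCategory.hom (A.map ((finiteSubsets Ω).map (homOfLE h)))

namespace Germ

variable {A Ω}

/-- The element of the colimit given by a finite subset and an element. -/
def mk (T : Finset Ω) (x : CC (A.obj ((finiteSubsets Ω).obj T))) : Germ A Ω :=
  Quotient.mk _ ⟨T, x⟩

/-- The germ of `x : A I` at an embedding of `I`. -/
noncomputable def germ {I : FI} (e : I.carrier ↪ Ω) (x : CC (A.obj I)) : Germ A Ω :=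
  mk (FI.image e) (ConcreteCategory.hom (A.map (FI.toSubset e _ (FI.apply_mem_image e))) x)

theorem mk_map {T T' : Finset Ω} (h : T ≤ T') (x : CC (A.obj ((finiteSubsets Ω).obj T))) :
    mk T' (ConcreteCategory.hom (A.map ((finiteSubsets Ω).map (homOfLE h))) x) = mk T x :=
  (DirectLimit.eq_of_le (F := fun T : Finset Ω => CC (A.obj ((finiteSubsets Ω).obj T)))
    (f := fun _ _ h =>
      ConcreteCategory.hom (A.map ((finiteSubsets Ω).map (homOfLE h))))
    (⟨T, x⟩ : Σ T : Finset Ω, CC (A.obj ((finiteSubsets Ω).obj T))) T' h).symm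

theorem germ_eq_mk {I : FI} (e : I.carrier ↪ Ω) (x : CC (A.obj I)) (T : Finset Ω)
    (h : ∀ y, e y ∈ T) :
    germ e x = mk T (ConcreteCategory.hom (A.map (FI.toSubset e T h)) x) := by
  have hle : FI.image e ≤ T := fun y hy => by
    obtain ⟨z, rfl⟩ := (FI.mem_image e).1 hy
    exact h z
  rw [germ, ← mk_map hle, ← ConcreteCategory.comp_apply, ← Functor.map_comp]
  rfl

theorem mk_eq_germ (T : Finset Ω) (x : CC (A.obj ((finiteSubsets Ω).obj T))) :
    mk T x = germ (FI.subsetEmb T) x := by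
  rw [germ_eq_mk (FI.subsetEmb T) x T fun y => y.2]
  have : FI.toSubset (FI.subsetEmb T) T (fun y => y.2) = 𝟙 _ := rfl
  rw [this, A.map_id, ConcreteCategory.id_apply]

theorem germ_map {I J : FI} (f : I ⟶ J) (e : J.carrier ↪ Ω) (x : CC (A.obj I)) :
    germ e (ConcreteCategory.hom (A.map f) x) =
      germ ((FI.embeddingOfHom f).trans e) x := by
  rw [germ_eq_mk e _ (FI.image e) (FI.apply_mem_image e),
    germ_eq_mk ((FI.embeddingOfHom f).trans e) x (FI.image e)
      fun y => FI.apply_mem_image e _, ← ConcreteCategory.comp_apply, ← Functor.map_comp]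
  rfl

theorem exists_eq_germ (z : Germ A Ω) :
    ∃ (T : Finset Ω) (x : CC (A.obj ((finiteSubsets Ω).obj T))), z = germ (FI.subsetEmb T) x := by
  obtain ⟨T, x, h⟩ := DirectLimit.exists_eq_mk _ z
  exact ⟨T, x, h.trans (mk_eq_germ T x)⟩

theorem exists_eq_germ_of_subset (z : Germ A Ω) (S : Finset Ω) :
    ∃ (T : Finset Ω) (x : CC (A.obj ((finiteSubsets Ω).obj T))), S ⊆ T ∧
      z = germ (FI.subsetEmb T) x := by
  obtain ⟨T, x, rfl⟩ := exists_eq_germ z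
  refine ⟨S ∪ T, ConcreteCategory.hom (A.map ((finiteSubsets Ω).map (homOfLE
    (Finset.subset_union_right : T ⊆ S ∪ T)))) x, Finset.subset_union_left, ?_⟩
  rw [germ_map]
  rfl

theorem exists_eq_germ₂ (z w : Germ A Ω) :
    ∃ (T : Finset Ω) (x y : CC (A.obj ((finiteSubsets Ω).obj T))),
      z = germ (FI.subsetEmb T) x ∧ w = germ (FI.subsetEmb T) y := by
  obtain ⟨T, x, y, h, h'⟩ := DirectLimit.exists_eq_mk₂ _ z w
  exact ⟨T, x, y, h.trans (mk_eq_germ T x), h'.trans (mk_eq_germ T y)⟩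

theorem germ_injective (hA : ∀ {I J : FI} (f : I ⟶ J),
    Function.Injective (ConcreteCategory.hom (A.map f))) {I : FI} (e : I.carrier ↪ Ω) :
    Function.Injective (germ (A := A) e) := by
  intro x y hxy
  exact hA _ (DirectLimit.mk_injective (F := fun T : Finset Ω => CC (A.obj ((finiteSubsets Ω).obj T)))
    (fun _ _ h => ConcreteCategory.hom (A.map ((finiteSubsets Ω).map (homOfLE h))))
    (fun _ _ _ => hA _) _ hxy)

/-- Functions out of the colimit. -/
def lift {Z : Type*} (φ : ∀ (I : FI), (I.carrier ↪ Ω) → CC (A.obj I) → Z)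
    (h : ∀ (I J : FI) (f : I ⟶ J) (e : J.carrier ↪ Ω) (x : CC (A.obj I)),
      φ J e (ConcreteCategory.hom (A.map f) x) = φ I ((FI.embeddingOfHom f).trans e) x) :
    Germ A Ω → Z :=
  DirectLimit.lift _ (fun T x => φ _ (FI.subsetEmb T) x) fun T T' hT x => by
    rw [h]
    rfl

theorem lift_germ {Z : Type*} (φ : ∀ (I : FI), (I.carrier ↪ Ω) → CC (A.obj I) → Z)
    (h : ∀ (I J : FI) (f : I ⟶ J) (e : J.carrier ↪ Ω) (x : CC (A.obj I)),
      φ J e (ConcreteCategory.hom (A.map f) x) = φ I ((FI.embeddingOfHom f).trans e) x)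
    {I : FI} (e : I.carrier ↪ Ω) (x : CC (A.obj I)) : lift φ h (germ e x) = φ I e x := by
  have : lift φ h (germ e x) = φ _ (FI.subsetEmb (FI.image e)) (ConcreteCategory.hom (A.map
    (FI.toSubset e _ (FI.apply_mem_image e))) x) := rfl
  rw [this, h]
  rfl

/-- The map of colimits induced by an embedding. -/
noncomputable def push {Ω' : Type} (g : Ω ↪ Ω') : Germ A Ω → Germ A Ω' :=
  lift (fun _ e x => germ (e.trans g) x) fun I J f e x => by
    rw [germ_map]
    rfl

theorem push_germ {Ω' : Type} (g : Ω ↪ Ω') {I : FI} (e : I.carrier ↪ Ω) (x : CC (A.obj I)) :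
    push g (germ e x) = germ (e.trans g) x :=
  lift_germ _ _ e x

noncomputable instance : MulAction (Equiv.Perm Ω) (Germ A Ω) where
  smul g := push g.toEmbedding
  one_smul z := by
    obtain ⟨T, x, rfl⟩ := exists_eq_germ z
    exact push_germ _ _ _
  mul_smul g h z := by
    obtain ⟨T, x, rfl⟩ := exists_eq_germ z
    change push _ _ = push _ (push _ _)
    rw [push_germ, push_germ, push_germ]
    rfl

theorem smul_germ (g : Equiv.Perm Ω) {I : FI} (e : I.carrier ↪ Ω) (x : CC (A.obj I)) :
    g • germ e x = germ (e.trans g.toEmbedding) x :=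
  push_germ _ e x

theorem supports_germ {I : FI} (e : I.carrier ↪ Ω) (x : CC (A.obj I)) :
    MulAction.Supports (Equiv.Perm Ω) (Set.range e) (germ e x) := by
  intro g hg
  rw [smul_germ]
  congr 1
  ext y
  exact hg ⟨y, rfl⟩

theorem finSupported (z : Germ A Ω) : FinSupported Ω z := by
  obtain ⟨T, x, rfl⟩ := exists_eq_germ z
  refine ⟨T, (supports_germ _ x).mono ?_⟩
  rintro _ ⟨y, rfl⟩
  exact y.2

end Germ

end Germs

namespace Germ

section Additive

variable {A : FI ⥤ AddCommGrpCat.{u}} {Ω : Type}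

noncomputable instance : AddCommGroup (Germ A Ω) :=
  inferInstanceAs (AddCommGroup (DirectLimit (fun T : Finset Ω => A.obj ((finiteSubsets Ω).obj T))
    fun _ _ h => ConcreteCategory.hom (A.map ((finiteSubsets Ω).map (homOfLE h)))))

theorem germ_add {I : FI} (e : I.carrier ↪ Ω) (x y : A.obj I) :
    germ e (x + y) = germ e x + germ e y := by
  rw [germ, map_add]
  exact (DirectLimit.add_def _ _ _).symm

noncomputable instance : DistribMulAction (Equiv.Perm Ω) (Germ A Ω) where
  smul_zero g := by
    have h : ∀ z w : Germ A Ω, g • (z + w) = g • z + g • w := by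
      intro z w
      obtain ⟨T, x, y, rfl, rfl⟩ := exists_eq_germ₂ z w
      rw [← germ_add, smul_germ, smul_germ, smul_germ, germ_add]
    have := h 0 0
    rwa [add_zero, left_eq_add] at this
  smul_add g z w := by
    obtain ⟨T, x, y, rfl, rfl⟩ := exists_eq_germ₂ z w
    rw [← germ_add, smul_germ, smul_germ, smul_germ, germ_add]

end Additive

section Ring

variable {A : FI ⥤ RingCat.{u}} {Ω : Type}

noncomputable instance : Ring (Germ A Ω) :=
  inferInstanceAs (Ring (DirectLimit (fun T : Finset Ω => A.obj ((finiteSubsets Ω).obj T))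
    fun _ _ h => ConcreteCategory.hom (A.map ((finiteSubsets Ω).map (homOfLE h)))))

/-- Germs as a ring homomorphism. -/
noncomputable def germHom {I : FI} (e : I.carrier ↪ Ω) : A.obj I →+* Germ A Ω where
  toFun := germ e
  map_one' := by
    rw [germ, map_one]
    exact (DirectLimit.one_def _).symm
  map_zero' := by
    rw [germ, map_zero]
    exact (DirectLimit.zero_def _).symm
  map_add' x y := by
    rw [germ, map_add]
    exact (DirectLimit.add_def _ _ _).symm
  map_mul' x y := by
    rw [germ, map_mul]
    exact (DirectLimit.mul_def _ _ _).symm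

theorem germHom_apply {I : FI} (e : I.carrier ↪ Ω) (x : A.obj I) : germHom e x = germ e x := rfl

noncomputable instance : MulSemiringAction (Equiv.Perm Ω) (Germ A Ω) where
  smul_one g := by
    have h : (1 : Germ A Ω) = germHom (FI.subsetEmb ∅) 1 := (map_one _).symm
    rw [h, germHom_apply, smul_germ, ← germHom_apply]
    exact (map_one (germHom _)).trans (map_one (germHom _)).symm
  smul_zero g := by
    have h : (0 : Germ A Ω) = germHom (FI.subsetEmb ∅) 0 := (map_zero _).symm
    rw [h, germHom_apply, smul_germ, ← germHom_apply]
    exact (map_zero (germHom _)).trans (map_zero (germHom _)).symm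
  smul_add g z w := by
    obtain ⟨T, x, y, rfl, rfl⟩ := exists_eq_germ₂ z w
    rw [← germHom_apply, ← germHom_apply, ← map_add, germHom_apply, germHom_apply, germHom_apply,
      smul_germ, smul_germ, smul_germ, ← germHom_apply, map_add]
    rfl
  smul_mul g z w := by
    obtain ⟨T, x, y, rfl, rfl⟩ := exists_eq_germ₂ z w
    rw [← germHom_apply, ← germHom_apply, ← map_mul, germHom_apply, germHom_apply, germHom_apply,
      smul_germ, smul_germ, smul_germ, ← germHom_apply, map_mul]
    rfl

end Ring

end Germ

/-! ### The sheaf condition for the atomic topology. -/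

namespace FI

/-- The sheaf condition on `FIᵒᵖ`, in terms of single injections. -/
theorem isSheaf_site_iff {C : Type*} [Category.{v} C] (P : FIᵒᵖᵒᵖ ⥤ C) :
    Presheaf.IsSheaf FI.site P ↔ ∀ (E : C) {I J : FI} (i : I ⟶ J) (h : E ⟶ P.obj (op (op J))),
      (∀ (Z : FI) (a b : J ⟶ Z), i ≫ a = i ≫ b → h ≫ P.map a.op.op = h ≫ P.map b.op.op) →
        ∃! h' : E ⟶ P.obj (op (op I)), h' ≫ P.map i.op.op = h := by
  have key : ∀ E : C, (∀ {I J : FI} (i : I ⟶ J) (h : E ⟶ P.obj (op (op J))),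
      (∀ (Z : FI) (a b : J ⟶ Z), i ≫ a = i ≫ b → h ≫ P.map a.op.op = h ≫ P.map b.op.op) →
        ∃! h' : E ⟶ P.obj (op (op I)), h' ≫ P.map i.op.op = h) ↔
      ∀ {X Y : FIᵒᵖ} (f : X ⟶ Y),
        Presieve.IsSheafFor (P ⋙ coyoneda.obj (op E)) (.singleton f) := by
    intro E
    constructor
    · intro H X Y f
      rw [Presieve.isSheafFor_singleton]
      intro x hx
      refine H f.unop x fun Z a b hab => hx a.op b.op ?_
      exact Quiver.Hom.unop_inj hab
    · intro H I J i h hh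
      refine Presieve.isSheafFor_singleton.1 (H i.op) h fun {Z} a b hab => ?_
      exact hh Z.unop a.unop b.unop (congrArg Quiver.Hom.unop hab)
  refine forall_congr' fun E => (Iff.trans ?_ (key E).symm)
  constructor
  · intro H X Y f
    rw [Presieve.isSheafFor_iff_generate]
    exact H _ ⟨X, f, Sieve.le_generate _ _ _ (Presieve.singleton_self f)⟩
  · intro H X S hS
    have hsep : ∀ {Y : FIᵒᵖ} (S : Sieve Y), S ∈ FI.site Y →
        Presieve.IsSeparatedFor (P ⋙ coyoneda.obj (op E)) (S : Presieve Y) := by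
      rintro Y S ⟨Z, f, hf⟩ x t₁ t₂ ht₁ ht₂
      refine (H f).isSeparatedFor.ext ?_
      rintro _ _ ⟨⟩
      rw [ht₁ f hf, ht₂ f hf]
    obtain ⟨Y, f, hf⟩ := hS
    -- A covering sieve contains one generated by a single arrow; separatedness on its pullbacks
    -- lets the sheaf property pass to the larger sieve.
    refine Presieve.isSheafFor_subsieve_aux _
      (S := Sieve.generate (Presieve.singleton f)) ?_ ?_ ?_
    · refine Sieve.generate_le_iff _ _ |>.2 ?_
      rintro _ _ ⟨⟩
      exact hf
    · exact (Presieve.isSheafFor_iff_generate _).1 (H f)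
    · intro Z g _
      exact hsep _ (FI.site.pullback_stable g ⟨Y, f, Sieve.le_generate _ _ _
        (Presieve.singleton_self f)⟩)

/-- The elements of a functor on `FI` with values in concrete categories that come from a
subset can be recognized by equations. -/
def Glues {C : Type*} [Category C] {FC : C → C → Type*} {CC : C → Type*}
    [∀ X Y, FunLike (FC X Y) (CC X) (CC Y)] [ConcreteCategory C FC] (A : FI ⥤ C) : Prop :=
  ∀ {I J : FI} (i : I ⟶ J) (x : CC (A.obj J)),
    (∀ (Z : FI) (a b : J ⟶ Z), i ≫ a = i ≫ b →
      ConcreteCategory.hom (A.map a) x = ConcreteCategory.hom (A.map b) x) →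
    ∃ y, ConcreteCategory.hom (A.map i) y = x

/-- All transition maps of a functor on `FI` are injective. -/
def MapsInjective {C : Type*} [Category C] {FC : C → C → Type*} {CC : C → Type*}
    [∀ X Y, FunLike (FC X Y) (CC X) (CC Y)] [ConcreteCategory C FC] (A : FI ⥤ C) : Prop :=
  ∀ {I J : FI} (i : I ⟶ J), Function.Injective (ConcreteCategory.hom (A.map i))

/-- The sheaf condition is tested on the subring of all elements that satisfy the gluing equations.
-/
theorem glues_of_isSheaf {P : FIᵒᵖᵒᵖ ⥤ RingCat.{u}} (hP : Presheaf.IsSheaf FI.site P) :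
    Glues (opOp FI ⋙ P) := by
  intro I J i x hx
  let E : Subring (P.obj (op (op J))) :=
    { carrier := {x | ∀ (Z : FI) (a b : J ⟶ Z), i ≫ a = i ≫ b →
        (P.map a.op.op).hom x = (P.map b.op.op).hom x}
      mul_mem' := fun hx hy Z a b hab => by rw [map_mul, map_mul, hx Z a b hab, hy Z a b hab]
      one_mem' := fun Z a b hab => by rw [map_one, map_one]
      add_mem' := fun hx hy Z a b hab => by rw [map_add, map_add, hx Z a b hab, hy Z a b hab]
      zero_mem' := fun Z a b hab => by rw [map_zero, map_zero]
      neg_mem' := fun hx Z a b hab => by rw [map_neg, map_neg, hx Z a b hab] }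
  obtain ⟨h', hh', -⟩ := (isSheaf_site_iff P).1 hP (RingCat.of E) i (RingCat.ofHom E.subtype) (by
    intro Z a b hab
    ext ⟨y, hy⟩
    exact hy Z a b hab)
  refine ⟨h'.hom ⟨x, fun Z a b hab => hx Z a b hab⟩, ?_⟩
  exact congrArg (fun f : RingCat.of E ⟶ P.obj (op (op J)) => f.hom ⟨x, fun Z a b hab =>
    hx Z a b hab⟩) hh'

/-- The inclusion of the kernel and the zero map have the same composite with the transition map, so
uniqueness in the sheaf condition identifies them. -/
theorem mapsInjective_of_isSheaf {P : FIᵒᵖᵒᵖ ⥤ AddCommGrpCat.{u}}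
    (hP : Presheaf.IsSheaf FI.site P) : MapsInjective (opOp FI ⋙ P) := by
  intro I J i
  refine (injective_iff_map_eq_zero (P.map i.op.op).hom).2 fun x hx => ?_
  let E : AddSubgroup (P.obj (op (op I))) := (P.map i.op.op).hom.ker
  obtain ⟨h', -, hu⟩ := (isSheaf_site_iff P).1 hP (AddCommGrpCat.of E) i 0 (by
    intro Z a b hab
    rw [zero_comp, zero_comp])
  have h₁ := hu (AddCommGrpCat.ofHom E.subtype) (by
    ext ⟨y, hy⟩
    exact hy)
  have h₂ := hu 0 zero_comp
  exact congrArg (fun f : AddCommGrpCat.of E ⟶ P.obj (op (op I)) => f.hom ⟨x, hx⟩) (h₁.trans h₂.symm)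

theorem isSheaf_of_glues {P : FIᵒᵖᵒᵖ ⥤ RingCat.{u}} (hi : MapsInjective (opOp FI ⋙ P))
    (hg : Glues (opOp FI ⋙ P)) : Presheaf.IsSheaf FI.site P := by
  refine (isSheaf_site_iff P).2 fun E I J i h hh => ?_
  have hr : ∀ x : E, h.hom x ∈ (P.map i.op.op).hom.range := fun x =>
    hg i (h.hom x) fun Z a b hab =>
      congrArg (fun f : E ⟶ P.obj (op (op Z)) => f.hom x) (hh Z a b hab)
  refine ⟨RingCat.ofHom ((RingEquiv.ofLeftInverse
    (Function.leftInverse_invFun (hi i))).symm.toRingHom.comp (h.hom.codRestrict _ hr)), ?_, ?_⟩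
  · ext x
    exact congrArg Subtype.val ((RingEquiv.ofLeftInverse
      (Function.leftInverse_invFun (hi i))).apply_symm_apply ⟨h.hom x, hr x⟩)
  · intro h' hh'
    ext x
    apply hi i
    refine Eq.trans ?_ (congrArg Subtype.val ((RingEquiv.ofLeftInverse
      (Function.leftInverse_invFun (hi i))).apply_symm_apply ⟨h.hom x, hr x⟩)).symm
    exact congrArg (fun f : E ⟶ P.obj (op (op J)) => f.hom x) hh'

theorem exists_perm_trans_eq {Ω : Type} {I : FI} (e e' : I.carrier ↪ Ω) :
    ∃ g : Equiv.Perm Ω, e.trans g.toEmbedding = e' := by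
  obtain ⟨g, hg⟩ := exists_perm_eqOn (image e) (Function.extend e e' id) (by
    intro s hs t ht hst
    obtain ⟨x, rfl⟩ := (mem_image e).1 hs
    obtain ⟨y, rfl⟩ := (mem_image e).1 ht
    rw [e.injective.extend_apply, e.injective.extend_apply] at hst
    rw [e'.injective hst])
  refine ⟨g, Function.Embedding.ext fun x => ?_⟩
  exact (hg _ (apply_mem_image e x)).trans (e.injective.extend_apply _ _ _)

end FI

namespace Germ

variable {C : Type*} [Category C] {FC : C → C → Type*} {CC : C → Type*}
  [∀ X Y, FunLike (FC X Y) (CC X) (CC Y)] [ConcreteCategory C FC] {A : FI ⥤ C} {Ω : Type}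

/-- A germ that is supported on a finite set comes from that set. -/
theorem exists_eq_germ_of_supports [Infinite Ω] (hi : FI.MapsInjective A) (hg : FI.Glues A)
    {I : FI} (e : I.carrier ↪ Ω) {z : Germ A Ω}
    (hz : MulAction.Supports (Equiv.Perm Ω) (Set.range e) z) : ∃ y : CC (A.obj I), z = germ e y := by
  obtain ⟨T, x, hT, rfl⟩ := exists_eq_germ_of_subset z (FI.image e)
  obtain ⟨y, hy⟩ := hg (FI.toSubset e T fun y => hT (FI.apply_mem_image e y)) x (by
    intro Z a b hab
    obtain ⟨c⟩ : Nonempty (Z.carrier ↪ Ω) :=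
      ⟨(Finite.equivFin Z.carrier).toEmbedding.trans
        (Fin.valEmbedding.trans (Infinite.natEmbedding Ω))⟩
    -- After embedding `Z` in `Ω`, `a` and `b` become permutations `g`, `g'` that agree on the image
    -- of `e`, which supports `z`; so they send `z` to the same germ.
    obtain ⟨g, hg⟩ := FI.exists_perm_trans_eq (FI.subsetEmb T) ((FI.embeddingOfHom a).trans c)
    obtain ⟨g', hg'⟩ := FI.exists_perm_trans_eq (FI.subsetEmb T) ((FI.embeddingOfHom b).trans c)
    apply germ_injective hi c
    rw [germ_map, germ_map, ← hg, ← hg', ← smul_germ, ← smul_germ, ← inv_smul_eq_iff, smul_smul]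
    refine hz _ fun s hs => ?_
    obtain ⟨i, rfl⟩ := hs
    have hi : e i ∈ T := hT (FI.apply_mem_image e i)
    rw [Equiv.Perm.smul_def, Equiv.Perm.mul_apply, Equiv.Perm.inv_eq_iff_eq]
    refine (DFunLike.congr_fun hg ⟨e i, hi⟩).trans (Eq.trans ?_
      (DFunLike.congr_fun hg' ⟨e i, hi⟩).symm)
    exact congrArg c (congrArg (fun f : I ⟶ Z => FI.embeddingOfHom f i) hab))
  refine ⟨y, ?_⟩
  rw [← hy, germ_map]
  rfl

end Germ

theorem IsField.ringHom_injective {R S : Type*} [Ring R] [Ring S] [Nontrivial S] (hR : IsField R)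
    (f : R →+* S) : Function.Injective f := by
  refine (injective_iff_map_eq_zero f).2 fun x hx => ?_
  by_contra h
  obtain ⟨y, hy⟩ := hR.mul_inv_cancel h
  have := congrArg f hy
  rw [map_mul, hx, zero_mul, map_one] at this
  exact zero_ne_one this

namespace FI

theorem mapsInjective_of_isField {A : FI ⥤ RingCat.{u}} (hA : ∀ I, IsField (A.obj I)) :
    MapsInjective A := fun {_ J} i =>
  have := (hA J).nontrivial
  (hA _).ringHom_injective (A.map i).hom

end FI

namespace Germ

variable {A : FI ⥤ RingCat.{u}} {Ω : Type}

theorem isField (hA : ∀ I, IsField (A.obj I)) : IsField (Germ A Ω) where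
  exists_pair_ne := by
    refine ⟨germHom (FI.subsetEmb ∅) 0, germHom (FI.subsetEmb ∅) 1, fun h => ?_⟩
    have := (hA ((finiteSubsets Ω).obj ∅)).nontrivial
    exact zero_ne_one (germ_injective (FI.mapsInjective_of_isField hA) _ h)
  mul_comm z w := by
    obtain ⟨T, x, y, rfl, rfl⟩ := exists_eq_germ₂ z w
    rw [← germHom_apply, ← germHom_apply, ← map_mul, ← map_mul, (hA _).mul_comm]
  mul_inv_cancel {z} hz := by
    obtain ⟨T, x, rfl⟩ := exists_eq_germ z
    have hx : x ≠ 0 := by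
      rintro rfl
      exact hz (map_zero (germHom _))
    obtain ⟨y, hy⟩ := (hA _).mul_inv_cancel hx
    refine ⟨germ (FI.subsetEmb T) y, ?_⟩
    rw [← germHom_apply, ← germHom_apply, ← map_mul, hy, map_one]

/-- If all permutations act trivially on the germs, the sheaf is constant. -/
theorem isConstantSheaf_of_smul_eq [Infinite Ω] {O : Sheaf FI.site RingCat.{u}}
    (hO : IsSheafOfFields O)
    (h : ∀ (g : Equiv.Perm Ω) (z : Germ (opOp FI ⋙ O.obj) Ω), g • z = z) : IsConstantSheaf O := by
  have hi : FI.MapsInjective (opOp FI ⋙ O.obj) :=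
    FI.mapsInjective_of_isField (A := opOp FI ⋙ O.obj) hO
  let E : FI := ⟨PEmpty⟩
  let ε : ∀ I : FI, E ⟶ I := fun I => FI.homOfEmbedding (I := E) ⟨PEmpty.elim, fun x => x.elim⟩
  have hε : ∀ (I : FI) (f : E ⟶ I), f = ε I := fun I f => FI.hom_ext fun x => x.elim
  -- A germ fixed by all permutations has empty support, so it comes from the value at the empty
  -- set.
  have hb : ∀ I, Function.Bijective (O.obj.map (ε I).op.op).hom := by
    refine fun I => ⟨hi (ε I), fun x => ?_⟩
    let e : I.carrier ↪ Ω :=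
      (Finite.equivFin I.carrier).toEmbedding.trans (Fin.valEmbedding.trans (Infinite.natEmbedding Ω))
    obtain ⟨y, hy⟩ := exists_eq_germ_of_supports hi (FI.glues_of_isSheaf O.property)
      ((FI.embeddingOfHom (ε I)).trans e) (z := germ e x) fun g _ => h g _
    refine ⟨y, germ_injective hi e ?_⟩
    exact (germ_map (ε I) e y).trans hy.symm
  refine ⟨O.obj.obj (op (op E)), ⟨(NatIso.ofComponents (fun I =>
    (RingEquiv.ofBijective _ (hb I.unop.unop)).toRingCatIso) fun {I J} f => ?_).symm⟩⟩
  change 𝟙 _ ≫ O.obj.map _ = O.obj.map _ ≫ O.obj.map f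
  rw [Category.id_comp, ← hε _ (ε I.unop.unop ≫ f.unop.unop), op_comp, op_comp, O.obj.map_comp]
  rfl

end Germ

/-! ### The colimit `𝒪̃` and its germs. -/

section Tilde

variable (M : Type) (O : FIᵒᵖᵒᵖ ⥤ RingCat.{u})

/-- The values of `𝒪̃` are colimits. -/
noncomputable def tildeIsColimit (I : FI) : IsColimit
    (((evaluation FIᵒᵖᵒᵖ RingCat.{u}).obj (op (op I))).mapCocone
      (colimit.cocone (finiteSubsets M ⋙ shift O))) :=
  isColimitOfPreserves _ (colimit.isColimit _)

variable {O}

/-- The structure maps of the colimit `𝒪̃(I)`. -/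
noncomputable def tildeι (J : Finset M) (I : FI) :
    O.obj (op (op (I.sum ((finiteSubsets M).obj J)))) →+* (tilde M O).obj (op (op I)) :=
  ((colimit.ι (finiteSubsets M ⋙ shift O) J).app (op (op I))).hom

variable {M}

theorem exists_eq_tildeι {I : FI} (z : (tilde M O).obj (op (op I))) :
    ∃ (J : Finset M) (x : O.obj (op (op (I.sum ((finiteSubsets M).obj J))))),
      z = tildeι M J I x := by
  have := preservesSmallestFilteredColimits_of_preservesFilteredColimits (forget RingCat.{u})
  obtain ⟨J, x, h⟩ := Concrete.isColimit_exists_rep _ (tildeIsColimit M O I) z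
  exact ⟨J, x, h.symm⟩

theorem tilde_map_tildeι {I I' : FI} (f : I ⟶ I') (J : Finset M)
    (x : O.obj (op (op (I.sum ((finiteSubsets M).obj J))))) :
    ((tilde M O).map f.op.op).hom (tildeι M J I x) =
      tildeι M J I' ((O.map (FI.sumMap f (𝟙 _)).op.op).hom x) :=
  (congrArg (fun g : O.obj (op (op (I.sum ((finiteSubsets M).obj J)))) ⟶
    (tilde M O).obj (op (op I')) => g.hom x)
    ((colimit.ι (finiteSubsets M ⋙ shift O) J).naturality f.op.op)).symm

theorem tildeι_map {I : FI} {J J' : Finset M} (h : J ⟶ J')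
    (x : O.obj (op (op (I.sum ((finiteSubsets M).obj J))))) :
    tildeι M J' I ((O.map (FI.sumMap (𝟙 I) ((finiteSubsets M).map h)).op.op).hom x) =
      tildeι M J I x :=
  congrArg (fun g : O.obj (op (op (I.sum ((finiteSubsets M).obj J)))) ⟶
    (tilde M O).obj (op (op I)) => g.hom x)
    (congrArg (fun g => NatTrans.app g (op (op I)))
      (colimit.w (finiteSubsets M ⋙ shift O) h))

theorem exists_eq_tildeι₂ {I : FI} (z w : (tilde M O).obj (op (op I))) :
    ∃ (J : Finset M) (x y : O.obj (op (op (I.sum ((finiteSubsets M).obj J))))),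
      z = tildeι M J I x ∧ w = tildeι M J I y := by
  classical
  obtain ⟨J, x, rfl⟩ := exists_eq_tildeι z
  obtain ⟨J', y, rfl⟩ := exists_eq_tildeι w
  exact ⟨J ∪ J', _, _, (tildeι_map (homOfLE Finset.subset_union_left) x).symm,
    (tildeι_map (homOfLE Finset.subset_union_right) y).symm⟩

variable {Ψ : Type}

/-- The sum of an embedding and the inclusion of a finite subset. -/
def FI.sumEmb {I : FI} (e : I.carrier ↪ Ψ) (J : Finset M) :
    (I.sum ((finiteSubsets M).obj J)).carrier ↪ Ψ ⊕ M :=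
  Function.Embedding.sumMap e (FI.subsetEmb J)

/-- The germs at an embedding of `I`, as a cocone with the base of the colimit `𝒪̃(I)`. -/
noncomputable def tildeCocone {I : FI} (e : I.carrier ↪ Ψ) : Cocone
    ((finiteSubsets M ⋙ shift O) ⋙ (evaluation FIᵒᵖᵒᵖ RingCat.{u}).obj (op (op I))) where
  pt := RingCat.of (Germ (opOp FI ⋙ O) (Ψ ⊕ M))
  ι :=
    { app := fun J => RingCat.ofHom (Germ.germHom (A := opOp FI ⋙ O)
        (I := I.sum ((finiteSubsets M).obj J)) (FI.sumEmb e J))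
      naturality := fun J J' h => by
        ext x
        refine (Germ.germ_map (A := opOp FI ⋙ O)
          (FI.sumMap (𝟙 I) ((finiteSubsets M).map h)) (FI.sumEmb e J') x).trans ?_
        change _ = Germ.germ (A := opOp FI ⋙ O) (FI.sumEmb e J) x
        congr 1
        ext (y | y) <;> rfl }

/-- The germ of an element of `𝒪̃(I)` at an embedding of `I`. -/
noncomputable def tildeGerm {I : FI} (e : I.carrier ↪ Ψ) :
    (tilde M O).obj (op (op I)) →+* Germ (opOp FI ⋙ O) (Ψ ⊕ M) :=
  ((tildeIsColimit M O I).desc (tildeCocone e)).hom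

theorem tildeGerm_tildeι {I : FI} (e : I.carrier ↪ Ψ) (J : Finset M)
    (x : O.obj (op (op (I.sum ((finiteSubsets M).obj J))))) :
    tildeGerm e (tildeι M J I x) = Germ.germ (A := opOp FI ⋙ O)
      (I := I.sum ((finiteSubsets M).obj J)) (FI.sumEmb e J) x := by
  have h := (tildeIsColimit M O I).fac (tildeCocone e) J
  exact congrArg (fun g : O.obj (op (op (I.sum ((finiteSubsets M).obj J)))) ⟶
    RingCat.of (Germ (opOp FI ⋙ O) (Ψ ⊕ M)) => g.hom x) h

theorem tildeGerm_map {I I' : FI} (f : I ⟶ I') (e : I'.carrier ↪ Ψ)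
    (z : (tilde M O).obj (op (op I))) :
    tildeGerm e (((tilde M O).map f.op.op).hom z) =
      tildeGerm ((FI.embeddingOfHom f).trans e) z := by
  obtain ⟨J, x, rfl⟩ := exists_eq_tildeι z
  rw [tilde_map_tildeι, tildeGerm_tildeι, tildeGerm_tildeι]
  refine (Germ.germ_map (A := opOp FI ⋙ O) (FI.sumMap f (𝟙 _)) _ x).trans ?_
  congr 1
  ext (y | y) <;> rfl

theorem smul_tildeGerm (g : Equiv.Perm Ψ) {I : FI} (e : I.carrier ↪ Ψ)
    (z : (tilde M O).obj (op (op I))) :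
    (Equiv.Perm.sumCongr g 1 : Equiv.Perm (Ψ ⊕ M)) • tildeGerm e z =
      tildeGerm (e.trans g.toEmbedding) z := by
  obtain ⟨J, x, rfl⟩ := exists_eq_tildeι z
  rw [tildeGerm_tildeι, tildeGerm_tildeι, Germ.smul_germ]
  congr 1
  ext (y | y) <;> rfl

/-- A finite support inside `e(I) ∪ M` lies in `e(I) ∪ J` with `J ⊆ M` finite, so the germ comes
from `O(I ⊔ J)`. -/
theorem exists_eq_tildeGerm [Infinite Ψ] (hi : FI.MapsInjective (opOp FI ⋙ O))
    (hg : FI.Glues (opOp FI ⋙ O)) {I : FI} (e : I.carrier ↪ Ψ)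
    {z : Germ (opOp FI ⋙ O) (Ψ ⊕ M)}
    (hz : MulAction.Supports (Equiv.Perm (Ψ ⊕ M))
      (Sum.inl '' Set.range e ∪ Set.range Sum.inr : Set (Ψ ⊕ M)) z) :
    ∃ y, z = tildeGerm e y := by
  obtain ⟨T, hT, hTz⟩ := (Germ.finSupported z).exists_subset hz (by
    have h : ((Set.range e)ᶜ).Infinite := (Set.finite_range e).infinite_compl
    refine (h.image (Sum.inl_injective (β := M)).injOn).mono ?_
    rintro _ ⟨x, hx, rfl⟩ (⟨y, hy, hxy⟩ | ⟨y, hxy⟩)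
    · exact hx (Sum.inl_injective hxy ▸ hy)
    · cases hxy)
  obtain ⟨y, rfl⟩ := Germ.exists_eq_germ_of_supports hi hg
    (I := I.sum ((finiteSubsets M).obj (T.preimage Sum.inr Sum.inr_injective.injOn)))
    (FI.sumEmb e _) (z := z) (hTz.mono (by
      intro x hx
      rcases hT hx with ⟨_, ⟨y, rfl⟩, rfl⟩ | ⟨y, rfl⟩
      · exact ⟨Sum.inl y, rfl⟩
      · exact ⟨Sum.inr ⟨y, Finset.mem_preimage.2 hx⟩, rfl⟩))
  exact ⟨_, (tildeGerm_tildeι e _ y).symm⟩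

theorem tilde_isField (hO : ∀ I : FI, IsField (O.obj (op (op I)))) (I : FI) :
    IsField ((tilde M O).obj (op (op I))) where
  exists_pair_ne := by
    refine ⟨0, 1, fun h => ?_⟩
    have := (Germ.isField (A := opOp FI ⋙ O) (Ω := I.carrier ⊕ M) hO).nontrivial
    have h' := congrArg (tildeGerm (M := M) (Function.Embedding.refl I.carrier)) h
    rw [map_zero, map_one] at h'
    exact zero_ne_one h'
  mul_comm z w := by
    obtain ⟨J, x, y, rfl, rfl⟩ := exists_eq_tildeι₂ z w
    rw [← map_mul, ← map_mul, (hO _).mul_comm]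
  mul_inv_cancel {z} hz := by
    obtain ⟨J, x, rfl⟩ := exists_eq_tildeι z
    have hx : x ≠ 0 := by
      rintro rfl
      exact hz (map_zero _)
    obtain ⟨y, hy⟩ := (hO _).mul_inv_cancel hx
    exact ⟨tildeι M J I y, by rw [← map_mul, hy, map_one]⟩

theorem tildeGerm_injective (hO : ∀ I : FI, IsField (O.obj (op (op I)))) {I : FI}
    (e : I.carrier ↪ Ψ) : Function.Injective (tildeGerm (M := M) (O := O) e) :=
  have := (Germ.isField (A := opOp FI ⋙ O) (Ω := Ψ ⊕ M) hO).nontrivial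
  (tilde_isField hO I).ringHom_injective _

theorem exists_eq_tildeGerm_of_fixed [Infinite Ψ] (hi : FI.MapsInjective (opOp FI ⋙ O))
    (hg : FI.Glues (opOp FI ⋙ O)) {I : FI} (e : I.carrier ↪ Ψ)
    {z : Germ (opOp FI ⋙ O) (Ψ ⊕ M)}
    (hz : ∀ g : Equiv.Perm Ψ, (∀ y, g (e y) = e y) →
      (Equiv.Perm.sumCongr g 1 : Equiv.Perm (Ψ ⊕ M)) • z = z) :
    ∃ y, z = tildeGerm e y := by
  classical
  refine exists_eq_tildeGerm hi hg e ((Germ.finSupported _).supports_of_swap ?_)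
  rintro (a | a) (b | b) ha hb -
  · have h : (Equiv.swap (Sum.inl a) (Sum.inl b) : Equiv.Perm (Ψ ⊕ M)) =
        Equiv.Perm.sumCongr (Equiv.swap a b) 1 := (Equiv.Perm.sumCongr_swap_one a b).symm
    have h' := hz (Equiv.swap a b) fun y => ?_
    · rw [← h] at h'
      convert h'
    refine Equiv.swap_apply_of_ne_of_ne ?_ ?_
    · rintro rfl
      exact ha (Or.inl ⟨_, ⟨y, rfl⟩, rfl⟩)
    · rintro rfl
      exact hb (Or.inl ⟨_, ⟨y, rfl⟩, rfl⟩)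
  · exact (hb (Or.inr ⟨b, rfl⟩)).elim
  · exact (ha (Or.inr ⟨a, rfl⟩)).elim
  · exact (ha (Or.inr ⟨a, rfl⟩)).elim

/-- Gluing data over `i : I ⟶ J` says that the germ over `ℕ ⊕ M` is fixed by the permutations of `ℕ`
that fix the image of `I`; such germs come from `𝒪̃(I)`. -/
theorem tilde_isSheaf {O : Sheaf FI.site RingCat.{u}} (hO : IsSheafOfFields O) :
    Presheaf.IsSheaf FI.site (tilde M O.obj) := by
  classical
  refine FI.isSheaf_of_glues
    (FI.mapsInjective_of_isField (A := opOp FI ⋙ tilde M O.obj) (tilde_isField hO)) ?_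
  intro I J i x hx
  let e : J.carrier ↪ ℕ := (Finite.equivFin J.carrier).toEmbedding.trans Fin.valEmbedding
  obtain ⟨y, hy⟩ := exists_eq_tildeGerm_of_fixed
    (FI.mapsInjective_of_isField (A := opOp FI ⋙ O.obj) hO) (FI.glues_of_isSheaf O.property)
    ((FI.embeddingOfHom i).trans e) (z := tildeGerm e x) (by
    intro g hg
    rw [smul_tildeGerm]
    let T := FI.image e ∪ FI.image (e.trans g.toEmbedding)
    let a : J ⟶ (finiteSubsets ℕ).obj T := FI.toSubset e T fun y =>
      Finset.mem_union_left _ (FI.apply_mem_image e y)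
    let b : J ⟶ (finiteSubsets ℕ).obj T := FI.toSubset (e.trans g.toEmbedding) T fun y =>
      Finset.mem_union_right _ (FI.apply_mem_image _ y)
    have hab := hx _ a b (FI.hom_ext fun y => Subtype.ext (hg y).symm)
    have := congrArg (tildeGerm (FI.subsetEmb T)) hab
    exact ((tildeGerm_map b _ x).symm.trans this.symm).trans (tildeGerm_map a _ x))
  refine ⟨y, tildeGerm_injective hO e ?_⟩
  exact (tildeGerm_map i e y).trans hy.symm

end Tilde

section Tilde

variable {M Ψ : Type} {O : FIᵒᵖᵒᵖ ⥤ RingCat.{u}}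

/-- The germs of `𝒪̃` map to the germs of `𝒪` over a larger set. -/
noncomputable def tildeGermHom : Germ (opOp FI ⋙ tilde M O) Ψ →+* Germ (opOp FI ⋙ O) (Ψ ⊕ M) :=
  have h : ∀ (I J : FI) (f : I ⟶ J) (e : J.carrier ↪ Ψ) (x : (tilde M O).obj (op (op I))),
      tildeGerm e (((tilde M O).map f.op.op).hom x) =
        tildeGerm ((FI.embeddingOfHom f).trans e) x := fun _ _ => tildeGerm_map
  let φ : Germ (opOp FI ⋙ tilde M O) Ψ → Germ (opOp FI ⋙ O) (Ψ ⊕ M) :=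
    Germ.lift (A := opOp FI ⋙ tilde M O) (fun _ e x => tildeGerm e x) h
  have hφ : ∀ {I : FI} (e : I.carrier ↪ Ψ) (x : (tilde M O).obj (op (op I))),
      φ (Germ.germHom (A := opOp FI ⋙ tilde M O) e x) = tildeGerm e x :=
    Germ.lift_germ (A := opOp FI ⋙ tilde M O) (fun _ e x => tildeGerm e x) h
  { toFun := φ
    map_one' := by
      rw [← map_one (Germ.germHom (A := opOp FI ⋙ tilde M O) (FI.subsetEmb ∅)), hφ]
      exact map_one _
    map_zero' := by
      rw [← map_zero (Germ.germHom (A := opOp FI ⋙ tilde M O) (FI.subsetEmb ∅)), hφ]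
      exact map_zero _
    map_add' := fun z w => by
      obtain ⟨T, x, y, rfl, rfl⟩ := Germ.exists_eq_germ₂ z w
      rw [← Germ.germHom_apply, ← Germ.germHom_apply, ← map_add, hφ, hφ, hφ]
      exact map_add _ _ _
    map_mul' := fun z w => by
      obtain ⟨T, x, y, rfl, rfl⟩ := Germ.exists_eq_germ₂ z w
      rw [← Germ.germHom_apply, ← Germ.germHom_apply, ← map_mul, hφ, hφ, hφ]
      exact map_mul _ _ _ }

theorem tildeGermHom_germ {I : FI} (e : I.carrier ↪ Ψ) (x : (tilde M O).obj (op (op I))) :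
    tildeGermHom (Germ.germ (A := opOp FI ⋙ tilde M O) e x) = tildeGerm e x :=
  Germ.lift_germ (A := opOp FI ⋙ tilde M O) (fun _ e x => tildeGerm e x)
    (fun _ _ => tildeGerm_map) e x

theorem tildeGermHom_smul (g : Equiv.Perm Ψ) (z : Germ (opOp FI ⋙ tilde M O) Ψ) :
    tildeGermHom (g • z) = (Equiv.Perm.sumCongr g 1 : Equiv.Perm (Ψ ⊕ M)) • tildeGermHom z := by
  obtain ⟨T, x, rfl⟩ := Germ.exists_eq_germ z
  rw [Germ.smul_germ, tildeGermHom_germ, tildeGermHom_germ, smul_tildeGerm]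

/-- Injective as a homomorphism of fields; surjective because a finite subset of `Ψ ⊕ M` splits into
a part in `Ψ` and a part in `M`. -/
theorem tildeGermHom_bijective [Infinite Ψ] (hO : ∀ I : FI, IsField (O.obj (op (op I))))
    (hg : FI.Glues (opOp FI ⋙ O)) :
    Function.Bijective (tildeGermHom (M := M) (Ψ := Ψ) (O := O)) := by
  constructor
  · have := (Germ.isField (A := opOp FI ⋙ O) (Ω := Ψ ⊕ M) hO).nontrivial
    exact (Germ.isField (A := opOp FI ⋙ tilde M O) (tilde_isField hO)).ringHom_injective _
  · intro z
    obtain ⟨T, hT⟩ := Germ.finSupported z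
    obtain ⟨y, hy⟩ := exists_eq_tildeGerm
      (FI.mapsInjective_of_isField (A := opOp FI ⋙ O) hO) hg
      (I := (finiteSubsets Ψ).obj (T.preimage Sum.inl Sum.inl_injective.injOn))
      (FI.subsetEmb _) (z := z) (hT.mono (by
        rintro (x | x) hx
        · exact Or.inl ⟨x, ⟨⟨x, Finset.mem_preimage.2 hx⟩, rfl⟩, rfl⟩
        · exact Or.inr ⟨x, rfl⟩))
    exact ⟨Germ.germ (A := opOp FI ⋙ tilde M O) _ y, (tildeGermHom_germ _ y).trans hy.symm⟩

end Tilde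

/-! ### Germs of modules. -/

namespace Germ

section Common

variable {A : FI ⥤ RingCat.{u}} {B : FI ⥤ AddCommGrpCat.{v}} {Ω : Type}

/-- Finitely many germs have a common domain of definition. -/
theorem exists_common (a b : Germ A Ω) (v w : Germ B Ω) :
    ∃ (T : Finset Ω) (x y : A.obj ((finiteSubsets Ω).obj T))
      (x' y' : B.obj ((finiteSubsets Ω).obj T)), a = germ (FI.subsetEmb T) x ∧
        b = germ (FI.subsetEmb T) y ∧ v = germ (FI.subsetEmb T) x' ∧
        w = germ (FI.subsetEmb T) y' := by
  classical
  obtain ⟨S, x, y, rfl, rfl⟩ := exists_eq_germ₂ a b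
  obtain ⟨S', x', y', rfl, rfl⟩ := exists_eq_germ₂ v w
  let f := (finiteSubsets Ω).map (homOfLE (Finset.subset_union_left : S ⊆ S ∪ S'))
  let f' := (finiteSubsets Ω).map (homOfLE (Finset.subset_union_right : S' ⊆ S ∪ S'))
  refine ⟨S ∪ S', ConcreteCategory.hom (A.map f) x, ConcreteCategory.hom (A.map f) y,
    ConcreteCategory.hom (B.map f') x', ConcreteCategory.hom (B.map f') y',
    ?_, ?_, ?_, ?_⟩ <;> rw [germ_map] <;> rfl

end Common

section Module

variable {A : FI ⥤ RingCat.{u}} {B : FI ⥤ AddCommGrpCat.{v}} {Ω : Type}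
  [∀ I, Module (A.obj I) (B.obj I)]

/-- The scalar multiplication of germs. -/
noncomputable def smul (h : ∀ {I J : FI} (f : I ⟶ J) (a : A.obj I) (x : B.obj I),
    (B.map f).hom (a • x) = (A.map f).hom a • (B.map f).hom x) :
    Germ A Ω → Germ B Ω → Germ B Ω :=
  DirectLimit.map₂
    (F₁ := fun T : Finset Ω => A.obj ((finiteSubsets Ω).obj T))
    (F₂ := fun T : Finset Ω => B.obj ((finiteSubsets Ω).obj T))
    (F := fun T : Finset Ω => B.obj ((finiteSubsets Ω).obj T))
    (fun _ _ h => ConcreteCategory.hom (A.map ((finiteSubsets Ω).map (homOfLE h))))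
    (fun _ _ h => ConcreteCategory.hom (B.map ((finiteSubsets Ω).map (homOfLE h))))
    (fun _ _ h => ConcreteCategory.hom (B.map ((finiteSubsets Ω).map (homOfLE h))))
    (fun _ a x => a • x) fun _ _ _ a x => h _ a x

theorem smul_germ_germ (h : ∀ {I J : FI} (f : I ⟶ J) (a : A.obj I) (x : B.obj I),
    (B.map f).hom (a • x) = (A.map f).hom a • (B.map f).hom x) {I : FI} (e : I.carrier ↪ Ω)
    (a : A.obj I) (x : B.obj I) : smul h (germ e a) (germ e x) = germ e (a • x) := by
  have : (ConcreteCategory.hom (B.map (FI.toSubset e _ (FI.apply_mem_image e)))) (a • x) =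
    (ConcreteCategory.hom (A.map (FI.toSubset e _ (FI.apply_mem_image e))) a) •
      (ConcreteCategory.hom (B.map (FI.toSubset e _ (FI.apply_mem_image e))) x) := h _ a x
  rw [germ, germ, germ, this]
  exact DirectLimit.map₂_def
    (F₁ := fun T : Finset Ω => A.obj ((finiteSubsets Ω).obj T))
    (F₂ := fun T : Finset Ω => B.obj ((finiteSubsets Ω).obj T))
    (F := fun T : Finset Ω => B.obj ((finiteSubsets Ω).obj T))
    (fun _ _ h => ConcreteCategory.hom (A.map ((finiteSubsets Ω).map (homOfLE h))))
    (fun _ _ h => ConcreteCategory.hom (B.map ((finiteSubsets Ω).map (homOfLE h))))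
    (fun _ _ h => ConcreteCategory.hom (B.map ((finiteSubsets Ω).map (homOfLE h))))
    (fun _ a x => a • x) (fun _ _ _ a x => h _ a x) _ _ _

/-- The module of germs over the ring of germs. -/
@[reducible] noncomputable def module (h : ∀ {I J : FI} (f : I ⟶ J) (a : A.obj I) (x : B.obj I),
    (B.map f).hom (a • x) = (A.map f).hom a • (B.map f).hom x) :
    Module (Germ A Ω) (Germ B Ω) where
  smul := smul h
  one_smul v := by
    obtain ⟨T, x, rfl⟩ := exists_eq_germ v
    have : (1 : Germ A Ω) = germ (FI.subsetEmb T) 1 := (map_one (germHom _)).symm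
    rw [this]
    change smul h _ _ = _
    rw [smul_germ_germ, one_smul]
  mul_smul a b v := by
    obtain ⟨T, x, y, x', -, rfl, rfl, rfl, -⟩ := exists_common a b v v
    rw [← germHom_apply, ← germHom_apply, ← map_mul]
    change smul h (germ _ _) _ = smul h (germ _ _) (smul h (germ _ _) _)
    rw [smul_germ_germ, smul_germ_germ, smul_germ_germ, mul_smul]
  smul_add a v w := by
    obtain ⟨T, x, -, x', y', rfl, -, rfl, rfl⟩ := exists_common a a v w
    rw [← germ_add]
    change smul h _ _ = smul h _ _ + smul h _ _
    rw [smul_germ_germ, smul_germ_germ, smul_germ_germ, smul_add, germ_add]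
  add_smul a b v := by
    obtain ⟨T, x, y, x', -, rfl, rfl, rfl, -⟩ := exists_common a b v v
    rw [← germHom_apply, ← germHom_apply, ← map_add]
    change smul h (germ _ _) _ = smul h (germ _ _) _ + smul h (germ _ _) _
    rw [smul_germ_germ, smul_germ_germ, smul_germ_germ, add_smul, germ_add]
  smul_zero a := by
    have hz : ∀ v w : Germ B Ω, smul h a (v + w) = smul h a v + smul h a w := by
      intro v w
      obtain ⟨T, x, -, x', y', rfl, -, rfl, rfl⟩ := exists_common a a v w
      rw [← germ_add, smul_germ_germ, smul_germ_germ, smul_germ_germ, smul_add, germ_add]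
    have := hz 0 0
    rwa [add_zero, left_eq_add] at this
  zero_smul v := by
    obtain ⟨T, x, rfl⟩ := exists_eq_germ v
    have : (0 : Germ A Ω) = germ (FI.subsetEmb T) 0 := (map_zero (germHom _)).symm
    rw [this]
    change smul h _ _ = _
    rw [smul_germ_germ, zero_smul, germ, map_zero]
    exact (DirectLimit.zero_def _).symm

theorem smul_smul_germ (h : ∀ {I J : FI} (f : I ⟶ J) (a : A.obj I) (x : B.obj I),
    (B.map f).hom (a • x) = (A.map f).hom a • (B.map f).hom x) (g : Equiv.Perm Ω)
    (a : Germ A Ω) (v : Germ B Ω) : g • smul h a v = smul h (g • a) (g • v) := by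
  obtain ⟨T, x, -, x', -, rfl, -, rfl, -⟩ := exists_common a a v v
  rw [smul_germ_germ, smul_germ, smul_germ, smul_germ, smul_germ_germ]

end Module

end Germ

theorem exists_equivariant_ne_zero_of_isField {Ψ M L V : Type*} [Infinite Ψ] [Infinite M] [Ring L]
    [MulSemiringAction (Equiv.Perm (Ψ ⊕ M)) L] (hL : IsField L)
    (hsm : ∀ a : L, FinSupported (Ψ ⊕ M) a)
    (hnt : ∃ (g : Equiv.Perm (Ψ ⊕ M)) (a : L), g • a ≠ a)
    [AddCommGroup V] [Module L V] [DistribMulAction (Equiv.Perm Ψ) V]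
    (hV : ∀ (g : Equiv.Perm Ψ) (a : L) (x : V),
      g • (a • x) = ((Equiv.Perm.sumCongr g 1 : Equiv.Perm (Ψ ⊕ M)) • a) • (g • x))
    (hVs : ∀ x : V, FinSupported Ψ x) {v : V} (hv : v ≠ 0) :
    ∃ ψ : V →ₗ[L] L, ψ v ≠ 0 ∧
      ∀ (g : Equiv.Perm Ψ) (w : V), ψ (g • w) =
        (Equiv.Perm.sumCongr g 1 : Equiv.Perm (Ψ ⊕ M)) • ψ w := by
  let _ : Field L := hL.toField
  let _ : MulSemiringAction (Equiv.Perm Ψ) L := MulSemiringAction.compHom L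
    ((Equiv.Perm.sumCongrHom Ψ M).comp (MonoidHom.inl (Equiv.Perm Ψ) (Equiv.Perm M)))
  exact exists_equivariant_ne_zero (Ψ := Ψ) (M := M) (L := L) (fun _ _ => rfl) hsm hnt hV hVs hv

/-! ### `𝒪̃` as a weak period sheaf. -/

section Tilde

variable {M : Type} [Infinite M] {O : Sheaf FI.site RingCat.{u}}

/-- There are enough equivariant functionals on the germs of modules over `𝒪̃`. -/
theorem exists_functional_ne_zero (hO : IsSheafOfFields O) (hc : ¬ IsConstantSheaf O)
    {B : FI ⥤ AddCommGrpCat.{v}} [∀ I, Module ((opOp FI ⋙ tilde M O.obj).obj I) (B.obj I)]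
    (h : ∀ {I J : FI} (f : I ⟶ J) (a : (opOp FI ⋙ tilde M O.obj).obj I) (x : B.obj I),
      (B.map f).hom (a • x) = ((opOp FI ⋙ tilde M O.obj).map f).hom a • (B.map f).hom x)
    {Ψ : Type} [Infinite Ψ] {v : Germ B Ψ} (hv : v ≠ 0) :
    ∃ ψ : Germ B Ψ →+ Germ (opOp FI ⋙ O.obj) (Ψ ⊕ M), ψ v ≠ 0 ∧
      (∀ a w, ψ (Germ.smul h a w) = tildeGermHom a * ψ w) ∧
      ∀ (g : Equiv.Perm Ψ) w, ψ (g • w) =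
        (Equiv.Perm.sumCongr g 1 : Equiv.Perm (Ψ ⊕ M)) • ψ w := by
  let Φ := RingEquiv.ofBijective _
    (tildeGermHom_bijective (M := M) (Ψ := Ψ) hO (FI.glues_of_isSheaf O.property))
  let _ := Germ.module (Ω := Ψ) h
  let _ : Module (Germ (opOp FI ⋙ O.obj) (Ψ ⊕ M)) (Germ B Ψ) :=
    Module.compHom _ (Φ.symm : _ →+* Germ (opOp FI ⋙ tilde M O.obj) Ψ)
  obtain ⟨ψ, hψ, hψg⟩ := exists_equivariant_ne_zero_of_isField (Ψ := Ψ) (M := M)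
    (Germ.isField (A := opOp FI ⋙ O.obj) (Ω := Ψ ⊕ M) hO) Germ.finSupported
    (by
      by_contra! hcon
      exact hc (Germ.isConstantSheaf_of_smul_eq hO hcon))
    (V := Germ B Ψ) (by
      intro g a x
      obtain ⟨a, rfl⟩ := Φ.surjective a
      have h1 : (Equiv.Perm.sumCongr g 1 : Equiv.Perm (Ψ ⊕ M)) • Φ a = Φ (g • a) :=
        (tildeGermHom_smul g a).symm
      rw [h1]
      change g • Germ.smul h (Φ.symm (Φ a)) x = Germ.smul h (Φ.symm (Φ (g • a))) (g • x)
      rw [Φ.symm_apply_apply, Φ.symm_apply_apply, Germ.smul_smul_germ])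
    Germ.finSupported hv
  refine ⟨ψ.toAddMonoidHom, hψ, fun a w => ?_, hψg⟩
  have := ψ.map_smul (Φ a) w
  change ψ (Germ.smul h (Φ.symm (Φ a)) w) = Φ a * ψ w at this
  rwa [Φ.symm_apply_apply] at this

/-- A section where `f` and `g` differ gives a nonzero germ over `ℕ`. An equivariant functional
detecting this germ takes germs from `Y(I)` to germs from `𝒪̃(I)`, by comparing stabilizers, and so
descends to a morphism of sheaves. -/
theorem isCoseparator_unit_tilde (hO : IsSheafOfFields O) (hc : ¬ IsConstantSheaf O)
    (h : Presheaf.IsSheaf FI.site (tilde M O.obj)) :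
    IsCoseparator (SheafOfModules.unit (⟨tilde M O.obj, h⟩ : Sheaf FI.site RingCat.{u})) := by
  rw [isCoseparator_def]
  intro X Y f g hfg
  by_contra hne
  obtain ⟨I, x, hx⟩ : ∃ (I : FIᵒᵖᵒᵖ) (x : X.val.obj I), f.val.app I x ≠ g.val.app I x := by
    by_contra! hcon
    refine hne (SheafOfModules.hom_ext (PresheafOfModules.hom_ext fun I => ?_))
    ext x
    exact hcon I x
  let B : FI ⥤ AddCommGrpCat.{u} := opOp FI ⋙ Y.val.presheaf
  let _ : ∀ I, Module ((opOp FI ⋙ tilde M O.obj).obj I) (B.obj I) := fun I =>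
    (Y.val.obj (op (op I))).isModule
  have hB : ∀ {I J : FI} (f : I ⟶ J) (a : (opOp FI ⋙ tilde M O.obj).obj I) (x : B.obj I),
      (B.map f).hom (a • x) = ((opOp FI ⋙ tilde M O.obj).map f).hom a • (B.map f).hom x :=
    fun f a x => Y.val.map_smul f.op.op a x
  have emb : ∀ I : FI, Nonempty (I.carrier ↪ ℕ) := fun I =>
    ⟨(Finite.equivFin I.carrier).toEmbedding.trans Fin.valEmbedding⟩
  obtain ⟨e₀⟩ := emb I.unop.unop
  let d : Y.val.obj I := f.val.app I x - g.val.app I x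
  have hd : Germ.germ (A := B) (I := I.unop.unop) e₀ d ≠ 0 := by
    intro h0
    refine sub_ne_zero.2 hx (Germ.germ_injective
      (FI.mapsInjective_of_isSheaf Y.isSheaf) e₀ (h0.trans ?_))
    have := Germ.germ_add (A := B) (I := I.unop.unop) e₀ 0 0
    rw [add_zero, left_eq_add] at this
    exact this.symm
  obtain ⟨ψ, hψ, hψs, hψg⟩ := exists_functional_ne_zero hO hc hB (Ψ := ℕ) hd
  let Λ : ∀ (I : FIᵒᵖᵒᵖ) (_ : I.unop.unop.carrier ↪ ℕ), Y.val.obj I →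
      Germ (opOp FI ⋙ O.obj) (ℕ ⊕ M) :=
    fun I e y => ψ (Germ.germ (A := B) (I := I.unop.unop) e y)
  have hadd : ∀ I e y y', Λ I e (y + y') = Λ I e y + Λ I e y' := fun I e y y' =>
    (congrArg ψ (Germ.germ_add (A := B) (I := I.unop.unop) e y y')).trans (map_add ψ _ _)
  have hsmul : ∀ (I : FIᵒᵖᵒᵖ) (e : I.unop.unop.carrier ↪ ℕ) (r : (tilde M O.obj).obj I)
      (y : Y.val.obj I), Λ I e (r • y) = tildeGerm (I := I.unop.unop) e r * Λ I e y := by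
    intro I e r y
    rw [← tildeGermHom_germ]
    exact (congrArg ψ (Germ.smul_germ_germ hB (I := I.unop.unop) e r y).symm).trans (hψs _ _)
  have hmap : ∀ (I J : FIᵒᵖᵒᵖ) (k : I ⟶ J) (e : J.unop.unop.carrier ↪ ℕ) (y : Y.val.obj I),
      Λ J e (Y.val.presheaf.map k y) =
        Λ I (Function.Embedding.trans (FI.embeddingOfHom k.unop.unop) e) y :=
    fun I J k e y => congrArg ψ (Germ.germ_map (A := B) k.unop.unop e y)
  have hperm : ∀ (g : Equiv.Perm ℕ) (I : FIᵒᵖᵒᵖ) (e : I.unop.unop.carrier ↪ ℕ)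
      (y : Y.val.obj I), Λ I (e.trans g.toEmbedding) y =
        (Equiv.Perm.sumCongr g 1 : Equiv.Perm (ℕ ⊕ M)) • Λ I e y := fun g I e y =>
    (congrArg ψ (Germ.smul_germ (A := B) g (I := I.unop.unop) e y).symm).trans (hψg _ _)
  have hΛ : Λ I e₀ d ≠ 0 := hψ
  clear_value Λ
  -- For one embedding `e`, the value at `y` is fixed by the stabilizer of `e`, hence comes from
  -- some `t`. Any two embeddings into `ℕ` differ by a permutation, so the same `t` serves all of
  -- them.
  have hex : ∀ (I : FIᵒᵖᵒᵖ) (y : Y.val.obj I), ∃ t : (tilde M O.obj).obj I,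
      ∀ e : I.unop.unop.carrier ↪ ℕ, tildeGerm (I := I.unop.unop) e t = Λ I e y := by
    intro I y
    obtain ⟨e⟩ := emb I.unop.unop
    obtain ⟨t, ht⟩ := exists_eq_tildeGerm_of_fixed
      (FI.mapsInjective_of_isField (A := opOp FI ⋙ O.obj) hO) (FI.glues_of_isSheaf O.property)
      e (z := Λ I e y) (by
        intro g hg
        rw [← hperm]
        congr 1
        exact Function.Embedding.ext hg)
    refine ⟨t, fun e' => ?_⟩
    obtain ⟨g, rfl⟩ := FI.exists_perm_trans_eq e e'
    rw [← smul_tildeGerm, hperm, ht]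
  choose θ hθ using hex
  have hinj : ∀ (I : FIᵒᵖᵒᵖ) (s t : (tilde M O.obj).obj I),
      (∀ e : I.unop.unop.carrier ↪ ℕ, tildeGerm (I := I.unop.unop) e s =
        tildeGerm (I := I.unop.unop) e t) → s = t := fun I s t hst => by
    obtain ⟨e⟩ := emb I.unop.unop
    exact tildeGerm_injective hO e (hst e)
  have hθadd : ∀ I y y', θ I (y + y') = θ I y + θ I y' := fun I y y' => hinj I _ _ fun e => by
    refine Eq.trans ?_ (map_add (tildeGerm (I := I.unop.unop) e) (θ I y) (θ I y')).symm
    rw [hθ, hθ, hθ, hadd]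
  let φ : Y.val.presheaf ⟶ (PresheafOfModules.unit (tilde M O.obj)).presheaf :=
    { app := fun I => AddCommGrpCat.ofHom (AddMonoidHom.mk' (θ I) (hθadd I))
      naturality := by
        intro I J k
        ext y
        refine hinj J _ _ fun e => ?_
        refine (hθ J _ e).trans (Eq.trans ?_ (tildeGerm_map k.unop.unop e (θ I y)).symm)
        exact (hmap I J k e y).trans (hθ I y _).symm }
  let Θ : Y.val ⟶ PresheafOfModules.unit (tilde M O.obj) := PresheafOfModules.homMk φ (by
    intro I r m
    refine hinj I _ _ fun e => ?_
    refine (hθ I _ e).trans (Eq.trans ?_ (map_mul (tildeGerm (I := I.unop.unop) e) r (θ I m)).symm)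
    rw [hθ, hsmul])
  have hΘ : θ I (f.val.app I x) = θ I (g.val.app I x) := by
    have := hfg (⟨Θ⟩ : Y ⟶ SheafOfModules.unit (⟨tilde M O.obj, h⟩ : Sheaf FI.site RingCat.{u}))
    exact congrArg (fun k : X ⟶ SheafOfModules.unit
      (⟨tilde M O.obj, h⟩ : Sheaf FI.site RingCat.{u}) => k.val.app I x) this
  have h1 := hθadd I d (g.val.app I x)
  rw [sub_add_cancel, hΘ, right_eq_add] at h1
  rw [← hθ I d e₀, h1] at hΛ
  exact hΛ (map_zero _)

theorem isWeakPeriodSheaf_tilde (hO : IsSheafOfFields O) (hc : ¬ IsConstantSheaf O) :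
    IsWeakPeriodSheaf (O := O) (P := ⟨tilde M O.obj, tilde_isSheaf hO⟩) ⟨toTilde M O.obj⟩ where
  isSheafOfFields_base := hO
  isSheafOfFields := tilde_isField hO
  injective I :=
    have := (tilde_isField (M := M) hO I).nontrivial
    (hO I).ringHom_injective _
  isCoseparator := isCoseparator_unit_tilde hO hc _

end Tilde

theorem mainTheorem7 :
    (∀ (O : Sheaf FI.site RingCat.{u}), IsSheafOfFields O → ¬ IsConstantSheaf O →
      ∀ (M : Type) [Infinite M],
        ∃ h : Presheaf.IsSheaf FI.site (tilde M O.obj),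
          IsWeakPeriodSheaf (O := O) (P := ⟨tilde M O.obj, h⟩) ⟨toTilde M O.obj⟩) ∧
    (∀ (Ψ : Type v) [Infinite Ψ] (K : Type u) [Field K] [MulSemiringAction (Equiv.Perm Ψ) K],
      IsSmoothAction (Equiv.Perm Ψ) Ψ K →
        ∃ (L : Type (max u v)) (_ : Field L) (_ : MulSemiringAction (Equiv.Perm Ψ) L)
          (_ : Algebra K L), IsWeakPeriodExtension (Equiv.Perm Ψ) Ψ K L) :=
  ⟨fun _ hO hc _ _ => ⟨tilde_isSheaf hO, isWeakPeriodSheaf_tilde hO hc⟩,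
    fun Ψ _ K _ _ h => exists_isWeakPeriodExtension Ψ K h⟩
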